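/- Let $A$ be a finite alphabet. A language is a subset of $A^*$, and a class is a set of languages over $A$. A *prevariety* is a class $\mathcal C$ of regular languages that contains $\emptyset$ and $A^*$, is closed under union, intersection and complement, and satisfies $u^{-1}L=\{w\mid uw\in L\}\in\mathcal C$ and $Lu^{-1}=\{w\mid wu\in L\}\in\mathcal C$ for all $L\in\mathcal C$ and $u\in A^*$. The *star-free closure* $\mathrm{SF}(\mathcal C)$ is the least class that contains $\mathcal C$ and all singletons $\{a\}$ with $a\in A$ and is closed under union, complement and concatenation. For a word $w=a_1\cdots a_n\in A^*$, the positions of $w$ are $0,1,\dots,n+1$; position $i$ with $1\le i\le n$ carries the letter $a_i$, and positions $0$ and $n+1$ carry no letter. For positions $i<j$, let $w(i,j)=a_{i+1}\cdots a_{j-1}$. The $\mathrm{LTLP}[\mathcal C]$ formulas are built from the atomic formulas $\top$, $\mathit{min}$, $\mathit{max}$ and $a$ (for $a\in A$) with $\vee$, $\wedge$, $\neg$ and the binary modalities $\varphi\,\mathrm U_L\,\psi$ and $\varphi\,\mathrm S_L\,\psi$ for $L\in\mathcal C$. The $\mathrm{LTL}[\mathcal C]$ formulas are those that contain no modality $\mathrm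 S_L$. The relation $w,i\models\varphi$, for a position $i$ of $w$, is defined inductively: $\top$ always holds, $\mathit{min}$ holds iff $i=0$, $\mathit{max}$ holds iff $i=n+1$, $a$ holds iff position $i$ carries the letter $a$, Boolean connectives are interpreted as usual, and - $w,i\models\varphi\,\mathrm U_L\,\psi$ iff there is a position $j>i$ with $w(i,j)\in L$, $w,j\models\psi$, and $w,k\models\varphi$ for all $i<k<j$; - $w,i\models\varphi\,\mathrm S_L\,\psi$ iff there is a position $j<i$ with $w(j,i)\in L$, $w,j\models\psi$, and $w,k\models\varphi$ for all $j<k<i$. The formula $\varphi$ defines the language $\{w\in A^*\mid w,0\models\varphi\}$. Let $\mathrm{LTL}(\mathcal C)$ and $\mathrm{LTLP}(\mathcal C)$ be the classes of languages defined by the $\mathrm{LTL}[\mathcal C]$ formulas and by the $\mathrm{LTLP}[\mathcal C]$ formulas, respectively. **Theorem.** For every prevariety $\mathcal C$ over $A$, $\mathrm{SF}(\mathcal C)=\mathrm{LTL}(\mathcal C)=\mathrm{LTLP}(\mathcal C)$. -/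

import Mathlib

namespace StarFreeLTL

universe u

variable {A : Type u}

/-- The right quotient `L u⁻¹ = {w | w u ∈ L}`. The left quotient `u⁻¹ L = {w | u w ∈ L}` is Mathlib's
`Language.leftQuotient`. -/
def rightQuotient (L : Language A) (u : List A) : Language A :=
  {w | w ++ u ∈ L}

/-- A prevariety over the alphabet `A`: a quotient-closed Boolean algebra of regular languages. -/
structure IsPrevariety (C : Set (Language A)) : Prop where
  empty_mem : (⊥ : Language A) ∈ C
  univ_mem : (⊤ : Language A) ∈ C
  union_mem : ∀ K ∈ C, ∀ L ∈ C, K ⊔ L ∈ C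
  inter_mem : ∀ K ∈ C, ∀ L ∈ C, K ⊓ L ∈ C
  compl_mem : ∀ K ∈ C, Kᶜ ∈ C
  leftQuotient_mem : ∀ L ∈ C, ∀ u : List A, L.leftQuotient u ∈ C
  rightQuotient_mem : ∀ L ∈ C, ∀ u : List A, rightQuotient L u ∈ C
  isRegular : ∀ L ∈ C, L.IsRegular

/-- Membership in the star-free closure of `C`: the least class that contains `C` and all singletons
`{a}` for letters `a`, and is closed under union, complement and concatenation. -/
inductive InStarFreeClosure (C : Set (Language A)) : Language A → Prop
  | base (L : Language A) (hL : L ∈ C) : InStarFreeClosure C L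
  | letter (a : A) : InStarFreeClosure C ({[a]} : Set (List A))
  | union (K L : Language A) (hK : InStarFreeClosure C K) (hL : InStarFreeClosure C L) :
      InStarFreeClosure C (K ⊔ L)
  | compl (K : Language A) (hK : InStarFreeClosure C K) : InStarFreeClosure C Kᶜ
  | concat (K L : Language A) (hK : InStarFreeClosure C K) (hL : InStarFreeClosure C L) :
      InStarFreeClosure C (K * L)

/-- The star-free closure `SF(C)`. -/
def SF (C : Set (Language A)) : Set (Language A) :=
  {L | InStarFreeClosure C L}

/-- The `LTLP[C]` formulas (future and past): the atomic formulas are `⊤`, `min`, `max` and the letters;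
the modalities `U_L` (`untl`) and `S_L` (`snce`) are indexed by the languages `L ∈ C`. -/
inductive Formula (C : Set (Language A)) : Type u
  | top : Formula C
  | atMin : Formula C
  | atMax : Formula C
  | letter (a : A) : Formula C
  | or (φ ψ : Formula C) : Formula C
  | and (φ ψ : Formula C) : Formula C
  | not (φ : Formula C) : Formula C
  | untl (L : Language A) (hL : L ∈ C) (φ ψ : Formula C) : Formula C
  | snce (L : Language A) (hL : L ∈ C) (φ ψ : Formula C) : Formula C

/-- The `LTL[C]` formulas (pure future) are the `LTLP[C]` formulas without any `S_L`. -/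
def Formula.IsFuture {C : Set (Language A)} : Formula C → Prop
  | .top => True
  | .atMin => True
  | .atMax => True
  | .letter _ => True
  | .or φ ψ => φ.IsFuture ∧ ψ.IsFuture
  | .and φ ψ => φ.IsFuture ∧ ψ.IsFuture
  | .not φ => φ.IsFuture
  | .untl _ _ φ ψ => φ.IsFuture ∧ ψ.IsFuture
  | .snce _ _ _ _ => False

/-- The positions of a word `w` are the natural numbers `0, 1, …, |w| + 1`. Position `i` with
`1 ≤ i ≤ |w|` carries the `i`-th letter of `w` (counted from one); `0` and `|w| + 1` carry no letter. -/
def label (w : List A) : ℕ → Option A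
  | 0 => none
  | i + 1 => w[i]?

/-- For positions `i < j` of `w = a₁ ⋯ aₙ`, the infix `w(i, j) = a_{i+1} ⋯ a_{j-1}` of the letters
strictly between `i` and `j`. -/
def wordInfix (w : List A) (i j : ℕ) : List A :=
  (w.drop i).take (j - i - 1)

/-- `w, i ⊨ φ`, for a position `i ≤ |w| + 1` of `w`. -/
def Formula.Sat {C : Set (Language A)} (w : List A) : ℕ → Formula C → Prop
  | _, .top => True
  | i, .atMin => i = 0
  | i, .atMax => i = w.length + 1
  | i, .letter a => label w i = some a
  | i, .or φ ψ => φ.Sat w i ∨ ψ.Sat w i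
  | i, .and φ ψ => φ.Sat w i ∧ ψ.Sat w i
  | i, .not φ => ¬ φ.Sat w i
  | i, .untl L _ φ ψ => ∃ j, i < j ∧ j ≤ w.length + 1 ∧ wordInfix w i j ∈ L ∧
      (∀ k, i < k → k < j → φ.Sat w k) ∧ ψ.Sat w j
  | i, .snce L _ φ ψ => ∃ j, j < i ∧ wordInfix w j i ∈ L ∧
      (∀ k, j < k → k < i → φ.Sat w k) ∧ ψ.Sat w j

/-- The language defined by a formula: formulas are evaluated at the leftmost position `0`. -/
def Formula.language {C : Set (Language A)} (φ : Formula C) : Language A :=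
  {w | φ.Sat w 0}

/-- `LTL(C)`: the languages defined by pure future formulas. -/
def LTL (C : Set (Language A)) : Set (Language A) :=
  {L | ∃ φ : Formula C, φ.IsFuture ∧ φ.language = L}

/-- `LTLP(C)`: the languages defined by formulas with future and past. -/
def LTLP (C : Set (Language A)) : Set (Language A) :=
  {L | ∃ φ : Formula C, φ.language = L}

end StarFreeLTL

/-!
Three inclusions are proved: `SF(C) ⊆ LTL(C)`, `LTL(C) ⊆ LTLP(C)`, which is trivial, and
`LTLP(C) ⊆ SF(C)`.

For `LTLP(C) ⊆ SF(C)` the argument uses congruences of finite index on `A*` whose classes are in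
`SF(C)`. Every language of `SF(C)` is saturated by one (`exists_finiteCongruence_SF`): for `L ∈ C`
it is the syntactic congruence, and concatenation is handled by the Schützenberger product. By
induction on a formula `φ` there is such a congruence for which the truth of `φ` at a position only
depends on the letter there and on the classes of the words before and after it
(`exists_isInvariant`). For `φ U_L ψ` at a position with prefix `p`, the set of the possible
remaining suffixes is in `SF(C)` and only depends on the class of `p`, so finitely many further
languages have to be saturated.

For `SF(C) ⊆ LTL(C)`, write `Future C` for the languages that pure future formulas define on
suffixes. A language `L` of `SF(C)` is aperiodic relative to `C`
(`exists_isStable_of_mem_SF`): there is a morphism from `A*` to a finite monoid `N` recognizing only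
languages of `C` such that, for words `v` with idempotent image, membership in `L` does not
distinguish large powers of `v`. This property passes through concatenations, because one side of a
cut of a large power still contains a large power. Therefore words with idempotent image in `N` act
aperiodically on the states of the minimal automaton of `L`. For such automata,
`exists_Future_of_isRelAperiodic` shows that the words leading from one state to another form a
language of `Future C`, by induction on the number of states and the number of letters. If all
letters are injective on states, the image in `N` determines the action of a word, and a single until
suffices. Otherwise some letter `c` is not injective, and a word is cut at the occurrences of `c`.
The blocks between them have fewer letters. The sequence of blocks is a word over a new finite
alphabet that acts on the smaller state set `δ c '' Q`, and formulas over the new alphabet translate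
back (`exists_Future_blocks`). The monoid `N` stays the same throughout: a block `b` gets the weight
of the word `b c`, so relative aperiodicity is inherited.
-/

namespace StarFreeLTL

universe u

variable {A : Type u}

/-! ### Boolean classes of languages and finite congruences -/

/-- The language of the words that satisfy a predicate. -/
def ofPred (p : List A → Prop) : Language A :=
  {w | p w}

@[simp]
theorem mem_ofPred (p : List A → Prop) (w : List A) : w ∈ ofPred p ↔ p w :=
  Iff.rfl

/-- A class of languages that contains `∅` and is closed under union and complement, stated for
predicates on words. -/
structure IsBooleanClass (D : Set (Language A)) : Prop where
  false_mem : ofPred (fun _ => False) ∈ D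
  or_mem : ∀ p q : List A → Prop, ofPred p ∈ D → ofPred q ∈ D → ofPred (fun w => p w ∨ q w) ∈ D
  not_mem : ∀ p : List A → Prop, ofPred p ∈ D → ofPred (fun w => ¬ p w) ∈ D

namespace IsBooleanClass

variable {D : Set (Language A)}

theorem and_mem (hD : IsBooleanClass D) (p q : List A → Prop) (hp : ofPred p ∈ D)
    (hq : ofPred q ∈ D) : ofPred (fun w => p w ∧ q w) ∈ D := by
  have := hD.not_mem _ (hD.or_mem _ _ (hD.not_mem p hp) (hD.not_mem q hq))
  simpa only [not_or, not_not] using this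

theorem const_mem (hD : IsBooleanClass D) (P : Prop) : ofPred (fun _ : List A => P) ∈ D := by
  by_cases hP : P
  · simpa [hP] using hD.not_mem _ hD.false_mem
  · simpa [hP] using hD.false_mem

theorem exists_mem (hD : IsBooleanClass D) {ι : Type*} [Finite ι] (p : ι → List A → Prop)
    (hp : ∀ i, ofPred (p i) ∈ D) : ofPred (fun w => ∃ i, p i w) ∈ D := by
  have key : ∀ s : Set ι, s.Finite → ofPred (fun w => ∃ i ∈ s, p i w) ∈ D := by
    intro s hs
    induction s, hs using Set.Finite.induction_on with
    | empty => simpa using hD.false_mem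
    | insert _ _ ih => simpa using hD.or_mem _ _ (hp _) ih
  simpa using key Set.univ Set.finite_univ

theorem forall_mem (hD : IsBooleanClass D) {ι : Type*} [Finite ι] (p : ι → List A → Prop)
    (hp : ∀ i, ofPred (p i) ∈ D) : ofPred (fun w => ∀ i, p i w) ∈ D := by
  have := hD.not_mem _ (hD.exists_mem _ fun i => hD.not_mem _ (hp i))
  simpa only [not_exists, not_not] using this

end IsBooleanClass

theorem IsPrevariety.isBooleanClass {C : Set (Language A)} (hC : IsPrevariety C) :
    IsBooleanClass C where
  false_mem := hC.empty_mem
  or_mem _ _ hp hq := hC.union_mem _ hp _ hq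
  not_mem _ hp := hC.compl_mem _ hp

theorem isBooleanClass_SF {C : Set (Language A)} (hC : IsPrevariety C) :
    IsBooleanClass (SF C) where
  false_mem := .base _ hC.empty_mem
  or_mem _ _ hp hq := .union _ _ hp hq
  not_mem _ hp := .compl _ hp

/-- A congruence of finite index on `A*` whose classes belong to `D`. It is given by a map `f` to a
finite type, two words being congruent when they have the same image. -/
structure IsFiniteCongruence (D : Set (Language A)) {X : Type*} (f : List A → X) : Prop where
  finite : Finite X
  append : ∀ {u u' v v'}, f u = f u' → f v = f v' → f (u ++ v) = f (u' ++ v')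
  fiber_mem : ∀ x, ofPred (fun w => f w = x) ∈ D

/-- The congruence `f` saturates the language `L`: `L` is a union of classes. -/
def Saturates {X : Type*} (f : List A → X) (L : Language A) : Prop :=
  ∀ ⦃u v⦄, f u = f v → u ∈ L → v ∈ L

theorem Saturates.iff {X : Type*} {f : List A → X} {L : Language A} (h : Saturates f L)
    {u v : List A} (huv : f u = f v) : u ∈ L ↔ v ∈ L :=
  ⟨h huv, h huv.symm⟩

theorem IsFiniteCongruence.mem_of_saturates {D : Set (Language A)} (hD : IsBooleanClass D)
    {X : Type*} {f : List A → X} (hf : IsFiniteCongruence D f) {L : Language A}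
    (hL : Saturates f L) : L ∈ D := by
  have := hf.finite
  have h := hD.exists_mem (fun (x : X) w => f w = x ∧ ∃ u ∈ L, f u = x)
    fun x => hD.and_mem _ _ (hf.fiber_mem x) (hD.const_mem _)
  convert h using 1
  ext w
  constructor
  · exact fun hw => ⟨_, rfl, w, hw, rfl⟩
  · rintro ⟨x, rfl, u, hu, hux⟩
    exact hL hux hu

theorem IsFiniteCongruence.prodMk {D : Set (Language A)} (hD : IsBooleanClass D) {X Y : Type*}
    {f : List A → X} {g : List A → Y} (hf : IsFiniteCongruence D f) (hg : IsFiniteCongruence D g) :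
    IsFiniteCongruence D (fun w => (f w, g w)) where
  finite := by
    have := hf.finite
    have := hg.finite
    infer_instance
  append h h' := by
    simp only [Prod.mk.injEq] at h h' ⊢
    exact ⟨hf.append h.1 h'.1, hg.append h.2 h'.2⟩
  fiber_mem x := by
    simpa only [Prod.ext_iff] using hD.and_mem _ _ (hf.fiber_mem x.1) (hg.fiber_mem x.2)

theorem IsFiniteCongruence.pi {D : Set (Language A)} (hD : IsBooleanClass D) {ι : Type*} [Finite ι]
    {X : ι → Type*} {f : ∀ i, List A → X i} (hf : ∀ i, IsFiniteCongruence D (f i)) :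
    IsFiniteCongruence D (fun w i => f i w) where
  finite := by
    have := fun i => (hf i).finite
    infer_instance
  append h h' := funext fun i => (hf i).append (congrFun h i) (congrFun h' i)
  fiber_mem x := by
    simpa only [funext_iff] using hD.forall_mem _ fun i => (hf i).fiber_mem (x i)

theorem IsFiniteCongruence.mono {D D' : Set (Language A)} (h : D ⊆ D') {X : Type*}
    {f : List A → X} (hf : IsFiniteCongruence D f) : IsFiniteCongruence D' f :=
  ⟨hf.finite, hf.append, fun x => h (hf.fiber_mem x)⟩

/-- The syntactic congruence of a language of a prevariety has finite index by regularity. Its classes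
are Boolean combinations of two-sided quotients of the language, so they are in the prevariety again. -/
theorem IsPrevariety.exists_finiteCongruence {C : Set (Language A)} (hC : IsPrevariety C)
    {L : Language A} (hL : L ∈ C) :
    ∃ (X : Type u) (f : List A → X), IsFiniteCongruence C f ∧ Saturates f L := by
  have hB := hC.isBooleanClass
  let Q := Set.range L.leftQuotient
  have hQ : Finite Q := (hC.isRegular L hL).finite_range_leftQuotient
  -- The action of a word on the states of the minimal automaton.
  let f : List A → Q → Q := fun w K => ⟨K.1.leftQuotient w, by
    obtain ⟨_, y, rfl⟩ := K
    exact ⟨y ++ w, Language.leftQuotient_append _ _ _⟩⟩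
  have hQC : ∀ K : Q, K.1 ∈ C := by
    rintro ⟨_, y, rfl⟩
    exact hC.leftQuotient_mem _ hL _
  refine ⟨Q → Q, f, ⟨inferInstance, ?_, ?_⟩, ?_⟩
  · intro u u' v v' hu hv
    have hcomp : ∀ u v, f (u ++ v) = f v ∘ f u := by
      intro u v
      funext K
      exact Subtype.ext (Language.leftQuotient_append _ _ _)
    rw [hcomp, hcomp, hu, hv]
  · intro x
    -- `K u⁻¹` only depends on the set of states from which `u` is accepted.
    have hfin : ∀ K J : Q, ofPred (fun w => f w K = J) ∈ C := by
      intro K J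
      let acc : List A → Set Q := fun v => {I | v ∈ I.1}
      have h := hB.forall_mem
        (fun (S : Set.range acc) w => (w ++ S.2.choose ∈ K.1 ↔ S.2.choose ∈ J.1)) (by
          intro S
          have h1 : ofPred (fun w => w ++ S.2.choose ∈ K.1) ∈ C :=
            hC.rightQuotient_mem _ (hQC K) _
          by_cases hS : S.2.choose ∈ J.1
          · simpa only [hS, iff_true] using h1
          · simpa only [hS, iff_false] using hB.not_mem _ h1)
      convert h using 2
      funext w
      apply propext
      constructor
      · rintro rfl S
        rfl
      · intro hw
        apply Subtype.ext
        ext v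
        have h1 := (⟨acc v, v, rfl⟩ : Set.range acc).2.choose_spec
        have h2 := hw ⟨acc v, v, rfl⟩
        have h3 : ∀ I : Q, _ ∈ I.1 ↔ v ∈ I.1 := fun I => Set.ext_iff.1 h1 I
        exact (h3 (f w K)).symm.trans (h2.trans (h3 J))
    simpa only [funext_iff] using hB.forall_mem _ fun K => hfin K (x K)
  · intro u v huv hu
    have h : L.leftQuotient u = L.leftQuotient v :=
      congrArg Subtype.val (congrFun huv ⟨L, [], rfl⟩)
    have h1 : ([] : List A) ∈ L.leftQuotient u := by simpa using hu
    have h2 : ([] : List A) ∈ L.leftQuotient v := by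
      rw [← h]
      exact h1
    simpa using h2

variable {C : Set (Language A)}

theorem ofPred_concat_mem_SF (p q : List A → Prop) (hp : ofPred p ∈ SF C) (hq : ofPred q ∈ SF C) :
    ofPred (fun w => ∃ u v, p u ∧ q v ∧ u ++ v = w) ∈ SF C := by
  have h : ofPred (fun w => ∃ u v, p u ∧ q v ∧ u ++ v = w) = ofPred p * ofPred q := by
    ext w
    rw [Language.mem_mul]
    constructor
    · rintro ⟨u, v, hu, hv, rfl⟩
      exact ⟨u, hu, v, hv, rfl⟩
    · rintro ⟨u, hu, v, hv, rfl⟩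
      exact ⟨u, v, hu, hv, rfl⟩
  rw [h]
  exact .concat _ _ hp hq

theorem ofPred_singleton_mem_SF (a : A) : ofPred (fun w => w = [a]) ∈ SF C :=
  InStarFreeClosure.letter a

theorem ofPred_ne_nil_mem_SF [Finite A] (hC : IsPrevariety C) :
    ofPred (fun w : List A => w ≠ []) ∈ SF C := by
  have hB := isBooleanClass_SF hC
  have h := hB.exists_mem (fun (a : A) w => ∃ u v, u = [a] ∧ True ∧ u ++ v = w) fun a =>
    ofPred_concat_mem_SF _ _ (ofPred_singleton_mem_SF a) (hB.const_mem True)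
  convert h using 2
  funext w
  cases w <;> simp

/-- Every language of `SF(C)` is a union of classes of a finite congruence with classes in `SF(C)`.
For a concatenation `K L`, the congruence relates words that admit the same factorizations up to a
congruence for `K` and `L` (the Schützenberger product). -/
theorem exists_finiteCongruence_SF [Finite A] (hC : IsPrevariety C) {L : Language A}
    (hL : L ∈ SF C) :
    ∃ (X : Type u) (f : List A → X), IsFiniteCongruence (SF C) f ∧ Saturates f L := by
  have hB := isBooleanClass_SF hC
  induction hL with
  | base L hL =>
    obtain ⟨X, f, hf, hfL⟩ := hC.exists_finiteCongruence hL
    exact ⟨X, f, hf.mono fun L hL => .base L hL, hfL⟩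
  | letter a =>
    -- The congruence separates `ε`, `a` and the remaining words.
    refine ⟨ULift (Prop × Prop), fun w => ⟨(w = [], w = [a])⟩, ⟨inferInstance, ?_, ?_⟩, ?_⟩
    · intro u u' v v' hu hv
      simp only [ULift.up.injEq, Prod.mk.injEq, eq_iff_iff] at hu hv ⊢
      simp only [List.append_eq_nil_iff, List.append_eq_singleton_iff]
      tauto
    · rintro ⟨P, P'⟩
      simp only [ULift.up.injEq, Prod.mk.injEq, eq_iff_iff]
      have h1 : ofPred (fun w : List A => w = []) ∈ SF C := by
        simpa using hB.not_mem _ (ofPred_ne_nil_mem_SF hC)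
      have h2 := ofPred_singleton_mem_SF (C := C) a
      apply hB.and_mem
      · by_cases hP : P
        · simpa only [hP, iff_true] using h1
        · simpa only [hP, iff_false] using hB.not_mem _ h1
      · by_cases hP : P'
        · simpa only [hP, iff_true] using h2
        · simpa only [hP, iff_false] using hB.not_mem _ h2
    · intro u v huv hu
      simp only [ULift.up.injEq, Prod.mk.injEq, eq_iff_iff] at huv
      exact huv.2.1 hu
  | union K L _ _ ihK ihL =>
    obtain ⟨X, f, hf, hfK⟩ := ihK
    obtain ⟨Y, g, hg, hgL⟩ := ihL
    refine ⟨_, _, hf.prodMk hB hg, fun u v huv hu => ?_⟩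
    simp only [Prod.mk.injEq] at huv
    exact Or.imp (fun h => hfK huv.1 h) (fun h => hgL huv.2 h) hu
  | compl K _ ih =>
    obtain ⟨X, f, hf, hfK⟩ := ih
    exact ⟨X, f, hf, fun u v huv hu hv => hu (hfK huv.symm hv)⟩
  | concat K L _ _ ihK ihL =>
    obtain ⟨X, f, hf, hfK⟩ := ihK
    obtain ⟨Y, g, hg, hgL⟩ := ihL
    obtain ⟨Z, h, hh, hhK, hhL⟩ : ∃ (Z : Type u) (h : List A → Z), IsFiniteCongruence (SF C) h ∧
        Saturates h K ∧ Saturates h L := by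
      refine ⟨_, _, hf.prodMk hB hg, fun u v huv => ?_, fun u v huv => ?_⟩ <;>
        simp only [Prod.mk.injEq] at huv
      · exact hfK huv.1
      · exact hgL huv.2
    have := hh.finite
    let F : List A → Set (Z × Z) := fun w => {x | ∃ u v, h u = x.1 ∧ h v = x.2 ∧ u ++ v = w}
    refine ⟨Z × Set (Z × Z), fun w => (h w, F w), ⟨inferInstance, ?_, ?_⟩, ?_⟩
    · intro u u' v v' hu hv
      simp only [Prod.mk.injEq] at hu hv ⊢
      refine ⟨hh.append hu.1 hv.1, ?_⟩
      have key : ∀ {u u' v v'}, h u = h u' → F u = F u' → h v = h v' → F v = F v' →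
          F (u ++ v) ⊆ F (u' ++ v') := by
        rintro u u' v v' hu hFu hv hFv ⟨x, y⟩ ⟨s, t, hs, ht, hst⟩
        simp only at hs ht
        subst hs ht
        rcases List.append_eq_append_iff.1 hst with ⟨r, rfl, rfl⟩ | ⟨r, rfl, rfl⟩
        · have : (h s, h r) ∈ F u' := hFu ▸ ⟨s, r, rfl, rfl, rfl⟩
          obtain ⟨s', r', hs', hr', rfl⟩ := this
          exact ⟨s', r' ++ v', hs', hh.append hr' hv.symm, by simp⟩
        · have : (h r, h t) ∈ F v' := hFv ▸ ⟨r, t, rfl, rfl, rfl⟩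
          obtain ⟨r', t', hr', ht', rfl⟩ := this
          exact ⟨u' ++ r', t', hh.append hu.symm hr', ht', by simp⟩
      exact (key hu.1 hu.2 hv.1 hv.2).antisymm
        (key hu.1.symm hu.2.symm hv.1.symm hv.2.symm)
    · rintro ⟨z, S⟩
      simp only [Prod.mk.injEq]
      refine hB.and_mem _ _ (hh.fiber_mem z) ?_
      simp only [Set.ext_iff]
      refine hB.forall_mem _ fun x => ?_
      have h1 : ofPred (fun w => x ∈ F w) ∈ SF C :=
        ofPred_concat_mem_SF _ _ (hh.fiber_mem x.1) (hh.fiber_mem x.2)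
      by_cases hx : x ∈ S
      · simpa only [hx, iff_true] using h1
      · simpa only [hx, iff_false] using hB.not_mem _ h1
    · intro w w' hw hmem
      simp only [Prod.mk.injEq] at hw
      obtain ⟨u, hu, v, hv, rfl⟩ := hmem
      have : (h u, h v) ∈ F w' := hw.2 ▸ ⟨u, v, rfl, rfl, rfl⟩
      obtain ⟨u', v', hu', hv', rfl⟩ := this
      exact ⟨u', hhK hu'.symm hu, v', hhL hv'.symm hv, rfl⟩

/-! ### Suffix languages of pure future formulas -/

/-- The non-strict until on words: `Until L P Q w` holds when `w = y z` with `y ∈ L` and `z ∈ Q`,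
such that every suffix of `w` that is longer than `z` belongs to `P`. The recursion decides whether
`y` is empty. -/
def Until (L P Q : Language A) : List A → Prop
  | [] => [] ∈ L ∧ [] ∈ Q
  | a :: w => ([] ∈ L ∧ a :: w ∈ Q) ∨ (a :: w ∈ P ∧ Until (L.leftQuotient [a]) P Q w)

/-- The languages obtained from `∅` by union, complement, prepending a letter and the until
operators with index in `C`. They are the languages that pure future formulas define when a formula
at a position `i ≥ 1` is read as a property of the suffix `a_i ⋯ a_n`; the suffix at the rightmost
position is empty. -/
inductive InFuture (C : Set (Language A)) : Language A → Prop
  | false : InFuture C (ofPred fun _ => False)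
  | or (p q : List A → Prop) (hp : InFuture C (ofPred p)) (hq : InFuture C (ofPred q)) :
      InFuture C (ofPred fun w => p w ∨ q w)
  | not (p : List A → Prop) (hp : InFuture C (ofPred p)) : InFuture C (ofPred fun w => ¬ p w)
  | cons (a : A) (P : Language A) (hP : InFuture C P) :
      InFuture C (ofPred fun w => ∃ v ∈ P, w = a :: v)
  | untl (L : Language A) (hL : L ∈ C) (P Q : Language A) (hP : InFuture C P)
      (hQ : InFuture C Q) : InFuture C (ofPred (Until L P Q))

/-- The class of the languages `InFuture C`. -/
def Future (C : Set (Language A)) : Set (Language A) :=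
  {L | InFuture C L}

theorem isBooleanClass_Future (C : Set (Language A)) : IsBooleanClass (Future C) where
  false_mem := .false
  or_mem := .or
  not_mem := .not

theorem Future.mono {C C' : Set (Language A)} (h : C ⊆ C') : Future C ⊆ Future C' := by
  intro L hL
  induction hL with
  | false => exact .false
  | or p q _ _ ihp ihq => exact .or p q ihp ihq
  | not p _ ih => exact .not p ih
  | cons a P _ ih => exact .cons a P ih
  | untl L hL P Q _ _ ihP ihQ => exact .untl L (h hL) P Q ihP ihQ

theorem until_iff_exists_drop (L P Q : Language A) (w : List A) :
    Until L P Q w ↔ ∃ m ≤ w.length, w.take m ∈ L ∧ w.drop m ∈ Q ∧ ∀ k < m, w.drop k ∈ P := by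
  induction w generalizing L with
  | nil => simp [Until]
  | cons a w ih =>
    simp only [Until, ih]
    constructor
    · rintro (⟨hL, hQ⟩ | ⟨hP, m, hm, hL, hQ, hk⟩)
      · exact ⟨0, by simp, hL, hQ, by simp⟩
      · refine ⟨m + 1, by simpa using hm, hL, hQ, fun k hkm => ?_⟩
        cases k with
        | zero => exact hP
        | succ k => exact hk k (by omega)
    · rintro ⟨m, hm, hL, hQ, hk⟩
      cases m with
      | zero => exact .inl ⟨hL, hQ⟩
      | succ m =>
        exact .inr ⟨hk 0 (by omega), m, by simpa using hm, hL, hQ,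
          fun k hkm => hk (k + 1) (by omega)⟩

theorem label_eq_some_iff (w : List A) {i : ℕ} (hi : 1 ≤ i) (a : A) :
    label w i = some a ↔ w.drop (i - 1) = a :: w.drop i := by
  obtain ⟨i, rfl⟩ : ∃ k, i = k + 1 := ⟨i - 1, by omega⟩
  simp only [label, Nat.add_sub_cancel]
  constructor
  · intro h
    obtain ⟨h1, rfl⟩ := List.getElem?_eq_some_iff.1 h
    exact List.drop_eq_getElem_cons h1
  · intro h
    have := congrArg List.head? h
    simpa [List.head?_drop] using this

/-- The formula `φ` holds at a position `i ≥ 1` exactly when the suffix starting at `i` is in `P`. -/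
def Formula.DefinesSuffix (φ : Formula C) (P : Language A) : Prop :=
  φ.IsFuture ∧ ∀ (w : List A) (i : ℕ), 1 ≤ i → i ≤ w.length + 1 →
    (φ.Sat w i ↔ w.drop (i - 1) ∈ P)

theorem Formula.DefinesSuffix.sat_untl {φ ψ : Formula C} {P Q : Language A}
    (hφ : φ.DefinesSuffix P) (hψ : ψ.DefinesSuffix Q) (L : Language A) (hL : L ∈ C) (w : List A)
    (i : ℕ) : (Formula.untl L hL φ ψ).Sat w i ↔ i ≤ w.length ∧ Until L P Q (w.drop i) := by
  rw [until_iff_exists_drop]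
  simp only [Formula.Sat, wordInfix, List.drop_drop, List.length_drop]
  constructor
  · rintro ⟨j, hij, hj, hw, hk, hQ⟩
    refine ⟨by omega, j - i - 1, by omega, hw, ?_, fun k hkm => ?_⟩
    · have := (hψ.2 w j (by omega) hj).1 hQ
      rwa [show i + (j - i - 1) = j - 1 by omega]
    · exact (hφ.2 w (i + k + 1) (by omega) (by omega)).1 (hk _ (by omega) (by omega))
  · rintro ⟨hi, m, hm, hw, hQ, hk⟩
    refine ⟨i + m + 1, by omega, by omega, ?_, fun k hik hkm => ?_, ?_⟩
    · rwa [show i + m + 1 - i - 1 = m by omega]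
    · have := hk (k - i - 1) (by omega)
      rw [show i + (k - i - 1) = k - 1 by omega] at this
      exact (hφ.2 w k (by omega) (by omega)).2 this
    · exact (hψ.2 w (i + m + 1) (by omega) (by omega)).2 hQ

/-- The suffix languages definable by pure future formulas. -/
def SuffixDefinable (C : Set (Language A)) : Set (Language A) :=
  {P | ∃ φ : Formula C, φ.DefinesSuffix P}

theorem isBooleanClass_SuffixDefinable (C : Set (Language A)) :
    IsBooleanClass (SuffixDefinable C) where
  false_mem := ⟨.not .top, trivial, fun w i _ _ => by simp [Formula.Sat]⟩
  or_mem := by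
    rintro p q ⟨φ, hφ, hp⟩ ⟨ψ, hψ, hq⟩
    refine ⟨.or φ ψ, ⟨hφ, hψ⟩, fun w i hi hi' => ?_⟩
    simp [Formula.Sat, hp w i hi hi', hq w i hi hi']
  not_mem := by
    rintro p ⟨φ, hφ, hp⟩
    refine ⟨.not φ, hφ, fun w i hi hi' => ?_⟩
    simp [Formula.Sat, hp w i hi hi']

theorem until_top_bot_iff (P : Language A) (w : List A) : Until ⊤ ⊥ P w ↔ w ∈ P := by
  rw [until_iff_exists_drop]
  constructor
  · rintro ⟨m, -, -, h, hk⟩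
    cases m with
    | zero => exact h
    | succ m => exact (hk 0 (by omega)).elim
  · exact fun h => ⟨0, by simp, trivial, h, by simp⟩

/-- Since `⊥ U_⊤ φ` refers to the next position, `φ` can be evaluated at the successor. -/
theorem Formula.DefinesSuffix.sat_next {φ : Formula C} {P : Language A} (hφ : φ.DefinesSuffix P)
    (h : ⊤ ∈ C) (w : List A) (i : ℕ) :
    (Formula.untl ⊤ h (.not .top) φ).Sat w i ↔ i ≤ w.length ∧ w.drop i ∈ P := by
  have hbot : (Formula.not .top : Formula C).DefinesSuffix ⊥ :=
    ⟨trivial, fun w i _ _ => ⟨fun h => (h trivial).elim, fun h => h.elim⟩⟩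
  rw [hbot.sat_untl hφ, until_top_bot_iff]

theorem future_subset_suffixDefinable [Finite A] (hC : IsPrevariety C) :
    Future C ⊆ SuffixDefinable C := by
  have hB := isBooleanClass_SuffixDefinable C
  intro F hF
  induction hF with
  | false => exact hB.false_mem
  | or p q _ _ ihp ihq => exact hB.or_mem _ _ ihp ihq
  | not p _ ih => exact hB.not_mem _ ih
  | cons a P _ ih =>
    obtain ⟨φ, hφ⟩ := ih
    refine ⟨.and (.letter a) (.untl ⊤ hC.univ_mem (.not .top) φ), ⟨trivial, trivial, hφ.1⟩, ?_⟩
    intro w i hi hi'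
    change label w i = some a ∧ (Formula.untl ⊤ hC.univ_mem (.not .top) φ).Sat w i ↔
      ∃ v ∈ P, _ = a :: v
    rw [label_eq_some_iff w hi, hφ.sat_next]
    constructor
    · rintro ⟨h1, -, h3⟩
      exact ⟨_, h3, h1⟩
    · rintro ⟨v, hv, h⟩
      have hlen := congrArg List.length h
      have htail := congrArg List.tail h
      rw [List.tail_drop, Nat.sub_add_cancel hi, List.tail_cons] at htail
      simp only [List.length_drop, List.length_cons] at hlen
      exact ⟨htail ▸ h, by omega, htail ▸ hv⟩
  | untl L hL P Q _ _ ihP ihQ =>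
    obtain ⟨φ, hφ⟩ := ihP
    obtain ⟨ψ, hψ⟩ := ihQ
    -- The non-strict until at `a w` either stops at once, or it is `P` together with the strict
    -- until with index `a⁻¹ L`.
    have hstep : ∀ a : A, ofPred (fun w => ∃ v, w = a :: v ∧ a :: v ∈ P ∧
        Until (L.leftQuotient [a]) P Q v) ∈ SuffixDefinable C := by
      intro a
      refine ⟨.and (.letter a) (.and φ (.untl _ (hC.leftQuotient_mem L hL [a]) φ ψ)),
        ⟨trivial, hφ.1, hφ.1, hψ.1⟩, fun w i hi hi' => ?_⟩
      change label w i = some a ∧ φ.Sat w i ∧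
        (Formula.untl _ (hC.leftQuotient_mem L hL [a]) φ ψ).Sat w i ↔ ∃ v, _ = a :: v ∧ _ ∧ _
      rw [label_eq_some_iff w hi, hφ.sat_untl hψ, hφ.2 w i hi hi']
      constructor
      · rintro ⟨h1, h2, -, h3⟩
        exact ⟨_, h1, h1 ▸ h2, h3⟩
      · rintro ⟨v, h, h2, h3⟩
        have hlen := congrArg List.length h
        have htail := congrArg List.tail h
        rw [List.tail_drop, Nat.sub_add_cancel hi, List.tail_cons] at htail
        simp only [List.length_drop, List.length_cons] at hlen
        subst htail
        exact ⟨h, h ▸ h2, by omega, h3⟩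
    have h := hB.or_mem _ _ (hB.and_mem _ _ (hB.const_mem ([] ∈ L)) (show ofPred (· ∈ Q) ∈ _ from
      ⟨ψ, hψ⟩)) (hB.exists_mem _ hstep)
    convert h using 2
    funext w
    cases w with
    | nil => simp [Until]
    | cons a w => simp [Until]

theorem future_subset_LTL [Finite A] (hC : IsPrevariety C) : Future C ⊆ LTL C := by
  intro F hF
  obtain ⟨φ, hφ⟩ := future_subset_suffixDefinable hC hF
  refine ⟨.untl ⊤ hC.univ_mem (.not .top) φ, ⟨trivial, hφ.1⟩, ?_⟩
  ext w
  exact (hφ.sat_next hC.univ_mem w 0).trans (by simp)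

/-! ### Factorization of words at a marker letter -/

/-- The languages recognized by the monoid morphism `A* → N` that extends `g`. -/
def recognizedBy {N : Type*} [Monoid N] (g : A → N) : Set (Language A) :=
  {L | ∃ S : Set N, L = ofPred fun w => (w.map g).prod ∈ S}

theorem ofPred_cons_mem_Future {D : Set (Language A)} (a : A) (p : List A → Prop)
    (hp : ofPred p ∈ Future D) : ofPred (fun w => ∃ v, p v ∧ w = a :: v) ∈ Future D :=
  InFuture.cons a _ hp

theorem ofPred_head_mem_Future (D : Set (Language A)) (a : A) :
    ofPred (fun w => ∃ v, w = a :: v) ∈ Future D := by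
  simpa using ofPred_cons_mem_Future a _ ((isBooleanClass_Future D).const_mem True)

/-- When `P` contains all words that do not start with `c` and all words of `Q` do, an until with
arguments `P` and `Q` skips a prefix without the letter `c`. -/
theorem until_append_iff {c : A} {P Q : Language A} (hP : ∀ a w, a ≠ c → a :: w ∈ P)
    (hQ : ∀ a w, a ≠ c → a :: w ∉ Q) (L : Language A) {x : List A} (hx : c ∉ x) (z : List A) :
    Until L P Q (x ++ z) ↔ Until (L.leftQuotient x) P Q z := by
  induction x generalizing L with
  | nil => rfl
  | cons a x ih =>
    have hac : a ≠ c := fun h => hx (h ▸ List.mem_cons_self)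
    have hx' : c ∉ x := fun h => hx (List.mem_cons_of_mem _ h)
    rw [List.cons_append, Until, ih _ hx', ← Language.leftQuotient_append]
    simp [hP _ _ hac, hQ _ _ hac]

/-- The words `b₁ c b₂ c ⋯ b_k c x`. -/
def joinBlocks (c : A) {K : Set (List A)} (bs : List K) (x : List A) : List A :=
  bs.foldr (fun b w => b.1 ++ c :: w) x

@[simp]
theorem joinBlocks_nil (c : A) {K : Set (List A)} (x : List A) :
    joinBlocks c ([] : List K) x = x :=
  rfl

@[simp]
theorem joinBlocks_cons (c : A) {K : Set (List A)} (b : K) (bs : List K) (x : List A) :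
    joinBlocks c (b :: bs) x = b.1 ++ c :: joinBlocks c bs x :=
  rfl

theorem joinBlocks_append (c : A) {K : Set (List A)} (bs : List K) (x y : List A) :
    joinBlocks c bs (x ++ y) = joinBlocks c bs x ++ y := by
  induction bs with
  | nil => rfl
  | cons b bs ih => simp [ih]

theorem exists_eq_joinBlocks [DecidableEq A] (c : A) (B : Finset A) (w : List A)
    (hw : ∀ a ∈ w, a ∈ B) :
    ∃ (bs : List {x : List A | ∀ a ∈ x, a ∈ B.erase c}) (x : List A),
      (∀ a ∈ x, a ∈ B.erase c) ∧ w = joinBlocks c bs x := by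
  induction w with
  | nil => exact ⟨[], [], by simp, rfl⟩
  | cons a w ih =>
    obtain ⟨bs, x, hx, rfl⟩ := ih fun a ha => hw a (List.mem_cons_of_mem _ ha)
    by_cases hac : a = c
    · subst hac
      exact ⟨⟨[], by simp⟩ :: bs, x, hx, rfl⟩
    · have ha : a ∈ B.erase c := Finset.mem_erase.2 ⟨hac, hw a List.mem_cons_self⟩
      cases bs with
      | nil => exact ⟨[], a :: x, by simpa using ⟨Finset.mem_erase.1 ha, by simpa using hx⟩, rfl⟩
      | cons b bs =>
        refine ⟨⟨a :: b.1, ?_⟩ :: bs, x, hx, rfl⟩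
        intro d hd
        rcases List.mem_cons.1 hd with rfl | hd
        · exact ha
        · exact b.2 d hd

section

variable {N : Type*} [Monoid N] (g : A → N)

theorem top_mem_recognizedBy : (⊤ : Language A) ∈ recognizedBy g :=
  ⟨Set.univ, rfl⟩

theorem ofPred_notMem_mem_Future (c : A) :
    ofPred (fun w => c ∉ w) ∈ Future (recognizedBy g) := by
  have hB := isBooleanClass_Future (recognizedBy g)
  have h : ofPred (Until ⊤ ⊤ (ofPred fun w => ∃ v, w = c :: v)) ∈ Future (recognizedBy g) :=
    InFuture.untl _ (top_mem_recognizedBy g) _ _ (hB.const_mem True) (ofPred_head_mem_Future _ c)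
  convert hB.not_mem _ h using 2
  funext w
  rw [eq_iff_iff, not_iff_not, until_iff_exists_drop]
  constructor
  · intro hc
    obtain ⟨u, v, rfl⟩ := List.append_of_mem hc
    exact ⟨u.length, by simp, trivial, ⟨v, by simp⟩, fun _ _ => trivial⟩
  · rintro ⟨m, -, -, ⟨v, hv⟩, -⟩
    exact List.mem_of_mem_drop (hv ▸ List.mem_cons_self)

theorem ofPred_prod_mem_Future [Finite A] (S : Set N) :
    ofPred (fun w => (w.map g).prod ∈ S) ∈ Future (recognizedBy g) := by
  have hB := isBooleanClass_Future (recognizedBy g)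
  have hnil : ofPred (fun w : List A => w = []) ∈ Future (recognizedBy g) := by
    convert hB.not_mem _ (hB.exists_mem _ fun a => ofPred_head_mem_Future (recognizedBy g) a) using 2
    funext w
    cases w <;> simp
  have h : ofPred (Until (ofPred fun w => (w.map g).prod ∈ S) ⊤ (ofPred fun w => w = [])) ∈
      Future (recognizedBy g) :=
    InFuture.untl _ (by exact ⟨S, rfl⟩) _ _ (hB.const_mem True) hnil
  convert h using 2
  funext w
  rw [eq_iff_iff, until_iff_exists_drop]
  constructor
  · intro hw
    exact ⟨w.length, le_rfl, by simpa using hw, by simp, fun _ _ => trivial⟩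
  · rintro ⟨m, -, hw, hm, -⟩
    have hm' : w.drop m = [] := hm
    rw [List.drop_eq_nil_iff] at hm'
    rwa [mem_ofPred, List.take_of_length_le hm'] at hw

/-- A property of the block before the first marker `c` is expressible. -/
theorem exists_Future_firstBlock (c : A) {F : Language A} (hF : F ∈ Future (recognizedBy g)) :
    ∃ F' ∈ Future (recognizedBy g), ∀ x y, c ∉ x → (x ++ c :: y ∈ F' ↔ x ∈ F) := by
  have hB := isBooleanClass_Future (recognizedBy g)
  induction hF with
  | false => exact ⟨_, .false, fun _ _ _ => Iff.rfl⟩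
  | or p q _ _ ihp ihq =>
    obtain ⟨P, hP, hP'⟩ := ihp
    obtain ⟨Q, hQ, hQ'⟩ := ihq
    exact ⟨_, hB.or_mem _ _ hP hQ, fun x y hx => or_congr (hP' x y hx) (hQ' x y hx)⟩
  | not p _ ih =>
    obtain ⟨P, hP, hP'⟩ := ih
    exact ⟨_, hB.not_mem _ hP, fun x y hx => not_congr (hP' x y hx)⟩
  | cons a P _ ih =>
    obtain ⟨P', hP, hP'⟩ := ih
    by_cases hac : a = c
    · subst hac
      refine ⟨_, hB.false_mem, fun x y hx => ⟨False.elim, ?_⟩⟩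
      rintro ⟨v, -, rfl⟩
      exact hx List.mem_cons_self
    · refine ⟨_, .cons a _ hP, fun x y hx => ?_⟩
      cases x with
      | nil => simp [Ne.symm hac]
      | cons b x =>
        have hx' : c ∉ x := fun h => hx (List.mem_cons_of_mem _ h)
        simp only [mem_ofPred, List.cons_append, List.cons.injEq]
        constructor
        · rintro ⟨v, hv, rfl, rfl⟩
          exact ⟨x, (hP' x y hx').1 hv, rfl, rfl⟩
        · rintro ⟨v, hv, rfl, rfl⟩
          exact ⟨_, (hP' x y hx').2 hv, rfl, rfl⟩
  | untl L hL P Q _ _ ihP ihQ =>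
    obtain ⟨P', hP, hP'⟩ := ihP
    obtain ⟨Q', hQ, hQ'⟩ := ihQ
    -- The until must not move past the marker.
    refine ⟨_, .untl L hL _ _ (hB.and_mem _ _ hP (hB.not_mem _ (ofPred_head_mem_Future _ c))) hQ,
      fun x y hx => ?_⟩
    simp only [mem_ofPred]
    clear hL
    induction x generalizing L with
    | nil => simp [Until, ← hQ' [] y hx]
    | cons a x ih =>
      have hac : a ≠ c := fun h => hx (h ▸ List.mem_cons_self)
      have hx' : c ∉ x := fun h => hx (List.mem_cons_of_mem _ h)
      have hQ1 := hQ' (a :: x) y hx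
      have hP1 : a :: x ++ c :: y ∈ ofPred (fun w => w ∈ P' ∧ ¬ ∃ v, w = c :: v) ↔ a :: x ∈ P := by
        rw [mem_ofPred, hP' (a :: x) y hx]
        simp [hac]
      rw [List.cons_append] at hP1 hQ1
      rw [List.cons_append, Until, Until, ih _ hx', hQ1]
      exact or_congr_right (and_congr_left' hP1)

/-- A property of the suffix after the first marker `c` is expressible. -/
theorem exists_Future_afterFirst (c : A) {F : Language A} (hF : F ∈ Future (recognizedBy g)) :
    ∃ F' ∈ Future (recognizedBy g), ∀ x y, c ∉ x → (x ++ c :: y ∈ F' ↔ y ∈ F) := by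
  have hB := isBooleanClass_Future (recognizedBy g)
  refine ⟨_, .untl ⊤ (top_mem_recognizedBy g) _ _ (hB.not_mem _ (ofPred_head_mem_Future _ c)) (.cons c F hF),
    fun x y hx => ?_⟩
  rw [mem_ofPred, until_append_iff (c := c) _ _ _ hx]
  · have h1 : (⊤ : Language A).leftQuotient x = ⊤ := rfl
    have h2 : [] ∈ (⊤ : Language A) := trivial
    simp [Until, h1, h2]
  · rintro a w hac ⟨v, hv⟩
    exact hac (List.cons.inj hv).1
  · rintro a w hac ⟨v, -, hv⟩
    exact hac (List.cons.inj hv).1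

/-- A property of the block after the last marker `c` is expressible. -/
theorem exists_Future_lastBlock (c : A) {F : Language A} (hF : F ∈ Future (recognizedBy g)) :
    ∃ F' ∈ Future (recognizedBy g), ∀ u x, c ∉ x → (u ++ c :: x ∈ F' ↔ x ∈ F) := by
  have hB := isBooleanClass_Future (recognizedBy g)
  refine ⟨_, .untl ⊤ (top_mem_recognizedBy g) ⊤ _ (hB.const_mem True)
    (.cons c _ (hB.and_mem _ _ (ofPred_notMem_mem_Future g c) hF)), fun u x hx => ?_⟩
  rw [mem_ofPred, until_iff_exists_drop]
  constructor
  · rintro ⟨m, -, -, ⟨v, ⟨hcv, hv⟩, h⟩, -⟩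
    -- Both `v` and `x` are the suffix after the last occurrence of `c`.
    have h' : (u ++ c :: x).take m ++ c :: v = u ++ c :: x := by
      rw [← h, List.take_append_drop]
    rcases List.append_eq_append_iff.1 h' with ⟨r, -, hr⟩ | ⟨r, -, hr⟩
    · cases r with
      | nil => exact (List.cons.inj hr).2 ▸ hv
      | cons d r =>
        refine absurd ?_ hcv
        rw [(List.cons.inj hr).2]
        simp
    · cases r with
      | nil => exact (List.cons.inj hr).2 ▸ hv
      | cons d r =>
        refine absurd ?_ hx
        rw [(List.cons.inj hr).2]
        simp
  · intro h
    exact ⟨u.length, by simp, trivial, ⟨x, ⟨hx, h⟩, by simp⟩, fun _ _ => trivial⟩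

/-- Let `τ` replace the blocks of a word `b₁ c b₂ c ⋯ b_k c x` by letters of another alphabet. If
the fibers of `τ` are expressible and the weight of the letter `τ b` is the weight of the word
`b c`, then properties of the word `τ b₁ ⋯ τ b_k` are expressible. A position of the latter word
corresponds to the beginning of a block. -/
theorem exists_Future_blocks (c : A) {K : Set (List A)} (hK : ∀ x ∈ K, c ∉ x) {T : Type*}
    (τ : K → T) (hτ : ∀ t, ∃ F ∈ Future (recognizedBy g), ∀ b : K, b.1 ∈ F ↔ τ b = t)
    (g' : T → N) (hg' : ∀ b : K, g' (τ b) = (b.1.map g).prod * g c)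
    {F : Language T} (hF : F ∈ Future (recognizedBy g')) :
    ∃ F' ∈ Future (recognizedBy g), ∀ (bs : List K), ∀ x ∈ K,
      (joinBlocks c bs x ∈ F' ↔ bs.map τ ∈ F) := by
  have hB := isBooleanClass_Future (recognizedBy g)
  induction hF with
  | false => exact ⟨_, .false, fun _ _ _ => Iff.rfl⟩
  | or p q _ _ ihp ihq =>
    obtain ⟨P, hP, hP'⟩ := ihp
    obtain ⟨Q, hQ, hQ'⟩ := ihq
    exact ⟨_, hB.or_mem _ _ hP hQ, fun bs x hx => or_congr (hP' bs x hx) (hQ' bs x hx)⟩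
  | not p _ ih =>
    obtain ⟨P, hP, hP'⟩ := ih
    exact ⟨_, hB.not_mem _ hP, fun bs x hx => not_congr (hP' bs x hx)⟩
  | cons t P _ ih =>
    obtain ⟨P', hP, hP'⟩ := ih
    obtain ⟨F, hF, hF'⟩ := hτ t
    obtain ⟨F₁, hF₁, hF₁'⟩ := exists_Future_firstBlock g c hF
    obtain ⟨F₂, hF₂, hF₂'⟩ := exists_Future_afterFirst g c hP
    refine ⟨_, hB.and_mem _ _ (hB.not_mem _ (ofPred_notMem_mem_Future g c))
      (hB.and_mem _ _ hF₁ hF₂), fun bs x hx => ?_⟩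
    simp only [mem_ofPred]
    cases bs with
    | nil => simp [hK x hx]
    | cons b bs =>
      have h1 := hF₁' b.1 (joinBlocks c bs x) (hK _ b.2)
      have h2 := hF₂' b.1 (joinBlocks c bs x) (hK _ b.2)
      rw [joinBlocks_cons]
      change ¬ c ∉ _ ∧ _ ∈ F₁ ∧ _ ∈ F₂ ↔ _
      rw [h1, h2, hF' b, hP' bs x hx]
      constructor
      · rintro ⟨-, rfl, h⟩
        exact ⟨_, h, rfl⟩
      · rintro ⟨v, hv, h⟩
        rw [List.map_cons, List.cons.injEq] at h
        exact ⟨by simp, h.1, h.2 ▸ hv⟩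
  | untl L hL P Q _ _ ihP ihQ =>
    obtain ⟨P', hP, hP'⟩ := ihP
    obtain ⟨Q', hQ, hQ'⟩ := ihQ
    obtain ⟨S, rfl⟩ := hL
    have hP₁ := hB.or_mem _ _ (hB.not_mem _ (ofPred_head_mem_Future (recognizedBy g) c))
      (ofPred_cons_mem_Future c _ hP)
    have hQ₁ := ofPred_cons_mem_Future c _ hQ
    set P₁ : Language A := ofPred fun w => (¬ ∃ v, w = c :: v) ∨ ∃ v, v ∈ P' ∧ w = c :: v with hP₁d
    set Q₁ : Language A := ofPred fun w => ∃ v, v ∈ Q' ∧ w = c :: v with hQ₁d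
    have hPa : ∀ a w, a ≠ c → a :: w ∈ P₁ := by
      rintro a w hac
      refine .inl ?_
      rintro ⟨v, hv⟩
      exact hac (List.cons.inj hv).1
    have hQa : ∀ a w, a ≠ c → a :: w ∉ Q₁ := by
      rintro a w hac ⟨v, -, hv⟩
      exact hac (List.cons.inj hv).1
    have hPc : ∀ w, c :: w ∈ P₁ ↔ w ∈ P' := by simp [hP₁d]
    have hQc : ∀ w, c :: w ∈ Q₁ ↔ w ∈ Q' := by simp [hQ₁d]
    -- Stopping at the marker that precedes the target block adds the factor `g c` to the weight.
    let LA : N → Language A := fun n => ofPred fun w => n * (w.map g).prod * g c ∈ S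
    let LT : N → Language T := fun n => ofPred fun w => n * (w.map g').prod ∈ S
    have key : ∀ (bs : List K), ∀ x ∈ K, ∀ n, Until (LT n) P Q (bs.map τ) ↔
        (n ∈ S ∧ joinBlocks c bs x ∈ Q') ∨
          (joinBlocks c bs x ∈ P' ∧ Until (LA n) P₁ Q₁ (joinBlocks c bs x)) := by
      intro bs x hx
      induction bs with
      | nil =>
        intro n
        have hQx := hQ' [] x hx
        have hU := until_append_iff hPa hQa (LA n) (hK x hx) []
        rw [List.append_nil] at hU
        have hnil : [] ∉ Q₁ := by
          rintro ⟨v, -, hv⟩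
          cases hv
        have hn : [] ∈ LT n ↔ n ∈ S := by simp [LT]
        rw [joinBlocks_nil] at hQx ⊢
        rw [hU]
        simp [Until, hnil, hQx, hn]
      | cons b bs ih =>
        intro n
        have hn : [] ∈ LT n ↔ n ∈ S := by simp [LT]
        have hLT : (LT n).leftQuotient [τ b] = LT (n * g' (τ b)) := by
          ext w
          simp [LT, mul_assoc]
        have hLA : ((LA n).leftQuotient b.1).leftQuotient [c] = LA (n * g' (τ b)) := by
          ext w
          simp [LA, hg', mul_assoc]
        have hb : [] ∈ (LA n).leftQuotient b.1 ↔ n * g' (τ b) ∈ S := by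
          simp [LA, hg', mul_assoc]
        have hU : Until (LA n) P₁ Q₁ (joinBlocks c (b :: bs) x) ↔
            Until (LT (n * g' (τ b))) P Q (bs.map τ) := by
          rw [joinBlocks_cons, until_append_iff hPa hQa (LA n) (hK _ b.2), Until, hLA, hb, hPc,
            hQc, ih]
        rw [hU, hP' _ x hx, hQ' _ x hx, List.map_cons, Until, hLT, hn]
    have hL1 : LA 1 ∈ recognizedBy g := by
      refine ⟨{n | n * g c ∈ S}, ?_⟩
      simp [LA]
    refine ⟨_, hB.or_mem _ _ (hB.and_mem _ _ (hB.const_mem (1 ∈ S)) hQ)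
      (hB.and_mem _ _ hP (.untl (LA 1) hL1 P₁ Q₁ hP₁ hQ₁)), fun bs x hx => ?_⟩
    have h := key bs x hx 1
    have hLT1 : LT 1 = ofPred fun w => (w.map g').prod ∈ S := by simp [LT]
    rw [hLT1] at h
    exact h.symm

end

/-! ### Automata that are aperiodic relative to a finite monoid -/

/-- The action of words on the states of an automaton with transition function `δ`. -/
def act {Q : Type*} (δ : A → Q → Q) (w : List A) (q : Q) : Q :=
  w.foldl (fun q a => δ a q) q

theorem act_append {Q : Type*} (δ : A → Q → Q) (u v : List A) :
    act δ (u ++ v) = act δ v ∘ act δ u := by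
  funext q
  simp [act]

theorem act_cons {Q : Type*} (δ : A → Q → Q) (a : A) (w : List A) (q : Q) :
    act δ (a :: w) q = act δ w (δ a q) :=
  rfl

theorem act_flatten_replicate {Q : Type*} (δ : A → Q → Q) (u : List A) (k : ℕ) :
    act δ (List.replicate k u).flatten = (act δ u)^[k] := by
  induction k with
  | zero => rfl
  | succ k ih => rw [List.replicate_succ, List.flatten_cons, act_append, ih, Function.iterate_succ]

/-- Words over `B` whose weight in the monoid is idempotent act aperiodically on the states. -/
def IsRelAperiodic {N Q : Type*} [Monoid N] (g : A → N) (δ : A → Q → Q) (B : Set A) : Prop :=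
  ∀ v : List A, (∀ a ∈ v, a ∈ B) → IsIdempotentElem (v.map g).prod →
    ∃ m, (act δ v)^[m] = (act δ v)^[m + 1]

theorem exists_pow_succ_isIdempotentElem {N : Type*} [Monoid N] [Finite N] (x : N) :
    ∃ k, IsIdempotentElem (x ^ (k + 1)) := by
  obtain ⟨i, j, hne, hij⟩ := Finite.exists_ne_map_eq_of_infinite fun n : ℕ => x ^ n
  wlog hlt : i < j generalizing i j
  · exact this j i hne.symm hij.symm (by omega)
  obtain ⟨p, rfl⟩ := Nat.exists_eq_add_of_lt hlt
  have hij' : x ^ i = x ^ (i + p + 1) := hij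
  have hper : ∀ n, i ≤ n → ∀ t, x ^ (n + t * (p + 1)) = x ^ n := by
    intro n hn t
    induction t with
    | zero => simp
    | succ t ih =>
      rw [← ih]
      obtain ⟨d, hd⟩ := Nat.exists_eq_add_of_le (show i ≤ n + t * (p + 1) by omega)
      rw [show n + (t + 1) * (p + 1) = (i + p + 1) + d by rw [add_mul]; omega, hd,
        pow_add x (i + p + 1), ← hij', pow_add]
  refine ⟨i * (p + 1) + p, ?_⟩
  rw [IsIdempotentElem, ← pow_add,
    show i * (p + 1) + p + 1 = (i + 1) * (p + 1) by ring]
  exact hper _ (by nlinarith) _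

/-- If all letters act injectively, then relative aperiodicity means that words with idempotent
weight act trivially, so the action of a word is determined by its weight. -/
theorem IsRelAperiodic.act_eq {N Q : Type*} [Monoid N] [Finite N] {g : A → N}
    {δ : A → Q → Q} {B : Set A} (h : IsRelAperiodic g δ B)
    (hinj : ∀ a ∈ B, Function.Injective (δ a)) {u v : List A} (hu : ∀ a ∈ u, a ∈ B)
    (hv : ∀ a ∈ v, a ∈ B) (huv : (u.map g).prod = (v.map g).prod) : act δ u = act δ v := by
  have hact : ∀ w : List A, (∀ a ∈ w, a ∈ B) → Function.Injective (act δ w) := by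
    intro w hw
    induction w with
    | nil => exact Function.injective_id
    | cons a w ih =>
      exact (ih fun b hb => hw b (List.mem_cons_of_mem _ hb)).comp (hinj a (hw a List.mem_cons_self))
  have htriv : ∀ w : List A, (∀ a ∈ w, a ∈ B) → IsIdempotentElem (w.map g).prod →
      act δ w = id := by
    intro w hw hidem
    obtain ⟨m, hm⟩ := h w hw hidem
    funext q
    have := congrFun hm q
    rw [Function.iterate_succ_apply] at this
    exact ((hact w hw).iterate m this).symm
  obtain ⟨k, hk⟩ := exists_pow_succ_isIdempotentElem (u.map g).prod
  -- Compare `u` and `v` followed by `u ^ k`.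
  have hpow : (((List.replicate k u).flatten).map g).prod = (u.map g).prod ^ k := by
    induction k with
    | zero => simp
    | succ k ih => simp [List.replicate_succ, pow_succ', List.map_flatten, List.prod_flatten]
  have hmem : ∀ a ∈ (List.replicate k u).flatten, a ∈ B := by
    intro a ha
    obtain ⟨l, hl, hal⟩ := List.mem_flatten.1 ha
    exact hu a (List.eq_of_mem_replicate hl ▸ hal)
  have h1 : act δ (u ++ (List.replicate k u).flatten) = id := by
    apply htriv
    · exact fun a ha => (List.mem_append.1 ha).elim (hu a) (hmem a)
    · rwa [List.map_append, List.prod_append, hpow, ← pow_succ']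
  have h2 : act δ (v ++ (List.replicate k u).flatten) = id := by
    apply htriv
    · exact fun a ha => (List.mem_append.1 ha).elim (hv a) (hmem a)
    · rwa [List.map_append, List.prod_append, hpow, ← huv, ← pow_succ']
  rw [act_append] at h1 h2
  funext q
  exact hact _ hmem ((congrFun h1 q).trans (congrFun h2 q).symm)

/-- The inductive step for a letter `c` that does not act injectively: the words between two
occurrences of `c` become the letters of an automaton on the smaller state set `δ c '' Q`. -/
theorem exists_Future_of_not_injective {N A Q : Type u} [Monoid N] [Finite N] [Finite A] [Finite Q]
    [DecidableEq A] (g : A → N) (δ : A → Q → Q) (B : Finset A) (hB : IsRelAperiodic g δ B)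
    {c : A} (hc : c ∈ B)
    (ihB : ∀ q q', ∃ F ∈ Future (recognizedBy g), ∀ w : List A, (∀ a ∈ w, a ∈ B.erase c) →
      (w ∈ F ↔ act δ w q = q'))
    (ihQ : ∀ (T : Type u) [Finite T] (g' : T → N) (δ' : T → Set.range (δ c) → Set.range (δ c)),
      IsRelAperiodic g' δ' Set.univ → ∀ q q', ∃ F ∈ Future (recognizedBy g'),
        ∀ w : List T, w ∈ F ↔ act δ' w q = q')
    (q q' : Q) :
    ∃ F ∈ Future (recognizedBy g), ∀ w : List A, (∀ a ∈ w, a ∈ B) → (w ∈ F ↔ act δ w q = q') := by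
  have hBool := isBooleanClass_Future (recognizedBy g)
  choose F hF hF' using ihB
  let K : Set (List A) := {x | ∀ a ∈ x, a ∈ B.erase c}
  have hK : ∀ x ∈ K, c ∉ x := fun x hx hcx => (Finset.mem_erase.1 (hx c hcx)).1 rfl
  have hKB : ∀ x ∈ K, ∀ a ∈ x, a ∈ B := fun x hx a ha => Finset.mem_of_mem_erase (hx a ha)
  -- A block is replaced by its action on the states together with its weight.
  let τ₀ : K → (Q → Q) × N := fun b => (act δ b.1, (b.1.map g).prod)
  let T := Set.range τ₀
  let τ : K → T := Set.rangeFactorization τ₀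
  have hτsurj : Function.Surjective τ := Set.rangeFactorization_surjective
  have hτ : ∀ t, ∃ F ∈ Future (recognizedBy g), ∀ b : K, b.1 ∈ F ↔ τ b = t := by
    intro t
    refine ⟨_, hBool.and_mem _ _ (hBool.forall_mem _ fun q => hF q (t.1.1 q))
      (ofPred_prod_mem_Future g {t.1.2}), fun b => ?_⟩
    rw [Subtype.ext_iff, Prod.ext_iff, funext_iff]
    exact and_congr (forall_congr' fun q => hF' _ _ _ b.2) Iff.rfl
  let g' : T → N := fun t => t.1.2 * g c
  let δ' : T → Set.range (δ c) → Set.range (δ c) := fun t p => ⟨δ c (t.1.1 p.1), _, rfl⟩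
  have hg' : ∀ b : K, g' (τ b) = (b.1.map g).prod * g c := fun _ => rfl
  have hδ' : ∀ (bs : List K) (p : Set.range (δ c)),
      (act δ' (bs.map τ) p).1 = act δ (joinBlocks c bs []) p.1 := by
    intro bs
    induction bs with
    | nil => exact fun _ => rfl
    | cons b bs ih =>
      intro p
      rw [List.map_cons, act_cons, ih, joinBlocks_cons, act_append]
      rfl
  have hprod : ∀ bs : List K,
      ((bs.map τ).map g').prod = ((joinBlocks c bs []).map g).prod := by
    intro bs
    induction bs with
    | nil => rfl
    | cons b bs ih =>
      rw [List.map_cons, List.map_cons, List.prod_cons, ih, hg']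
      simp [mul_assoc]
  have hjoin : ∀ bs : List K, ∀ a ∈ joinBlocks c bs [], a ∈ B := by
    intro bs
    induction bs with
    | nil => simp
    | cons b bs ih =>
      intro a ha
      rw [joinBlocks_cons, List.mem_append, List.mem_cons] at ha
      rcases ha with ha | rfl | ha
      · exact hKB _ b.2 a ha
      · exact hc
      · exact ih a ha
  have hrel : IsRelAperiodic g' δ' Set.univ := by
    intro v _ hv
    obtain ⟨bs, rfl⟩ := (List.map_surjective_iff.2 hτsurj) v
    rw [hprod] at hv
    obtain ⟨m, hm⟩ := hB _ (hjoin bs) hv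
    have hiter : ∀ n p, ((act δ' (bs.map τ))^[n] p).1 = (act δ (joinBlocks c bs []))^[n] p.1 := by
      intro n
      induction n with
      | zero => exact fun _ => rfl
      | succ n ih =>
        intro p
        rw [Function.iterate_succ_apply, Function.iterate_succ_apply, ih, hδ']
    refine ⟨m, funext fun p => Subtype.ext ?_⟩
    rw [hiter, hiter, hm]
  choose E hE hE' using ihQ T g' δ' hrel
  have hblocks := fun p p' => exists_Future_blocks g c hK τ hτ g' hg' (hE p p')
  choose G hG hG' using hblocks
  have hfirst := fun p p' => exists_Future_firstBlock g c (hF p p')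
  choose H hH hH' using hfirst
  have hafter := fun p p' => exists_Future_afterFirst g c (hG p p')
  choose I hI hI' using hafter
  have hlast := fun p p' => exists_Future_lastBlock g c (hF p p')
  choose J hJ hJ' using hlast
  -- Guess the state `p` before the first marker and the state `p'` after the last one.
  refine ⟨_, hBool.or_mem _ _ (hBool.and_mem _ _ (ofPred_notMem_mem_Future g c) (hF q q'))
    (hBool.and_mem _ _ (hBool.not_mem _ (ofPred_notMem_mem_Future g c))
      (hBool.exists_mem _ fun p : Q => hBool.exists_mem _ fun p' : Set.range (δ c) =>
        hBool.and_mem _ _ (hH q p) (hBool.and_mem _ _ (hI ⟨δ c p, p, rfl⟩ p') (hJ p'.1 q')))),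
    fun w hw => ?_⟩
  obtain ⟨bs, x, hx, rfl⟩ := exists_eq_joinBlocks c B w hw
  cases bs with
  | nil =>
    have h1 := hK x hx
    have h2 := hF' q q' x hx
    rw [joinBlocks_nil]
    constructor
    · rintro (h | h)
      · exact h2.1 h.2
      · exact absurd h1 h.1
    · exact fun h => .inl ⟨h1, h2.2 h⟩
  | cons b bs =>
    have hmem : c ∈ joinBlocks c (b :: bs) x := by simp
    have hsplit : joinBlocks c (b :: bs) x = (b.1 ++ c :: joinBlocks c bs []) ++ x := by
      rw [← List.nil_append x, joinBlocks_append, joinBlocks_cons, List.nil_append]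
    -- The last marker is the one that ends the last block.
    have hend : ∃ u, joinBlocks c (b :: bs) x = u ++ c :: x := by
      have : ∀ (bs : List K) (b : K), ∃ u, joinBlocks c (b :: bs) x = u ++ c :: x := by
        intro bs
        induction bs with
        | nil => exact fun b => ⟨b.1, rfl⟩
        | cons b' bs ih =>
          intro b
          obtain ⟨u, hu⟩ := ih b'
          exact ⟨b.1 ++ c :: u, by rw [joinBlocks_cons, hu]; simp⟩
      exact this bs b
    have h1 : ∀ p, joinBlocks c (b :: bs) x ∈ H q p ↔ act δ b.1 q = p := fun p =>
      (hH' q p b.1 _ (hK _ b.2)).trans (hF' _ _ _ b.2)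
    have h2 : ∀ p p', joinBlocks c (b :: bs) x ∈ I p p' ↔
        act δ (joinBlocks c bs []) p.1 = p'.1 := fun p p' => by
      rw [joinBlocks_cons, hI' p p' b.1 _ (hK _ b.2), hG' p p' bs x hx, hE', Subtype.ext_iff, hδ']
    have h3 : ∀ p', joinBlocks c (b :: bs) x ∈ J p' q' ↔ act δ x p' = q' := fun p' => by
      obtain ⟨u, hu⟩ := hend
      rw [hu, hJ' p' q' u x (hK x hx), hF' _ _ _ hx]
    rw [hsplit, act_append, act_append, ← hsplit]
    constructor
    · rintro (h | ⟨-, p, p', ha, hb, hd⟩)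
      · exact absurd hmem h.1
      · rw [← (h3 p').1 hd, ← (h2 _ p').1 hb, ← (h1 p).1 ha]
        rfl
    · intro h
      let p' := act δ' (bs.map τ) ⟨δ c (act δ b.1 q), _, rfl⟩
      have hp' : p'.1 = act δ (joinBlocks c bs []) (δ c (act δ b.1 q)) := hδ' bs _
      refine .inr ⟨not_not.2 hmem, act δ b.1 q, p', (h1 _).2 rfl, (h2 _ _).2 hp'.symm, (h3 _).2 ?_⟩
      rw [hp']
      exact h

/-- If an automaton is aperiodic relative to the monoid `N`, the words that lead from `q` to `q'`
are given by a pure future formula with modalities recognized by `N`. The induction is on the number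
of states and, for a fixed automaton, on the number of letters that may occur. -/
theorem exists_Future_of_isRelAperiodic {N : Type u} [Monoid N] [Finite N] (n : ℕ) :
    ∀ (A Q : Type u) [Finite A] [Finite Q] (g : A → N) (δ : A → Q → Q), Nat.card Q = n →
      ∀ B : Finset A, IsRelAperiodic g δ B → ∀ q q', ∃ F ∈ Future (recognizedBy g),
        ∀ w : List A, (∀ a ∈ w, a ∈ B) → (w ∈ F ↔ act δ w q = q') := by
  classical
  induction n using Nat.strong_induction_on with
  | _ n ihn =>
    intro A Q _ _ g δ hn B
    induction B using Finset.strongInduction with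
    | H B ihB =>
      intro hB q q'
      by_cases hinj : ∀ a ∈ B, Function.Injective (δ a)
      · refine ⟨_, ofPred_prod_mem_Future g
          {x | ∃ w : List A, (∀ a ∈ w, a ∈ B) ∧ act δ w q = q' ∧ (w.map g).prod = x}, fun w hw => ?_⟩
        constructor
        · rintro ⟨v, hv, rfl, hvw⟩
          rw [hB.act_eq hinj hv hw hvw]
        · exact fun h => ⟨w, hw, h, rfl⟩
      · push Not at hinj
        obtain ⟨c, hc, hcinj⟩ := hinj
        refine exists_Future_of_not_injective g δ B hB hc ?_ ?_ q q'
        · refine ihB _ (Finset.erase_ssubset hc) fun v hv => hB v fun a ha => ?_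
          exact Finset.mem_of_mem_erase (hv a ha)
        · intro T _ g' δ' hrel p p'
          have hlt : Nat.card (Set.range (δ c)) < n := by
            rw [← hn]
            refine Set.ncard_lt_card fun h => hcinj ?_
            exact Finite.injective_iff_surjective.2 (Set.range_eq_univ.1 h)
          have := Fintype.ofFinite T
          obtain ⟨F, hF, hF'⟩ := ihn _ hlt T (Set.range (δ c)) g' δ' rfl Finset.univ
            (by simpa using hrel) p p'
          exact ⟨F, hF, fun w => hF' w (by simp)⟩

/-! ### From formulas with future and past to the star-free closure -/

/-- Whether `φ` holds at a position only depends on the label of the position and on the classes of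
the words before and after it. -/
structure IsInvariant {X : Type*} (f : List A → X) (φ : Formula C) : Prop where
  first : ∀ {w w'}, f w = f w' → (φ.Sat w 0 ↔ φ.Sat w' 0)
  last : ∀ {w w'}, f w = f w' → (φ.Sat w (w.length + 1) ↔ φ.Sat w' (w'.length + 1))
  letter : ∀ {u u'} (a : A) {v v'}, f u = f u' → f v = f v' →
    (φ.Sat (u ++ a :: v) (u.length + 1) ↔ φ.Sat (u' ++ a :: v') (u'.length + 1))

theorem IsInvariant.refine {X Y : Type*} {f : List A → X} {φ : Formula C} (h : IsInvariant f φ)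
    {g : List A → Y} (hg : ∀ {u v}, g u = g v → f u = f v) : IsInvariant g φ :=
  ⟨fun hw => h.first (hg hw), fun hw => h.last (hg hw), fun a _ _ hu hv => h.letter a (hg hu) (hg hv)⟩

/-- The words `x ∈ L` such that `φ` holds at all positions of `x` inside the word `p x s`. -/
def middle (L : Language A) (φ : Formula C) (p s : List A) : Language A :=
  ofPred fun x => x ∈ L ∧ ∀ x₁ c x₂, x = x₁ ++ c :: x₂ →
    φ.Sat ((p ++ x₁) ++ c :: (x₂ ++ s)) ((p ++ x₁).length + 1)

theorem mem_middle_iff (L : Language A) (φ : Formula C) (p x s : List A) :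
    x ∈ middle L φ p s ↔ wordInfix (p ++ x ++ s) p.length ((p ++ x).length + 1) ∈ L ∧
      ∀ k, p.length < k → k < (p ++ x).length + 1 → φ.Sat (p ++ x ++ s) k := by
  have hw : wordInfix (p ++ x ++ s) p.length ((p ++ x).length + 1) = x := by
    simp [wordInfix, show p.length + x.length + 1 - p.length - 1 = x.length by omega]
  rw [middle, mem_ofPred, hw]
  refine and_congr_right fun _ => ⟨fun h k hk hk' => ?_, ?_⟩
  · obtain ⟨i, rfl⟩ := Nat.exists_eq_add_of_lt hk
    have hi : i < x.length := by
      rw [List.length_append] at hk'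
      omega
    have hx : x = x.take i ++ x[i] :: x.drop (i + 1) := by simp
    have := h _ _ _ hx
    have hlen : (p ++ x.take i).length + 1 = p.length + i + 1 := by
      simp [Nat.min_eq_left hi.le]
    rw [hlen] at this
    convert this using 1
    simp only [List.append_assoc, ← List.cons_append]
    rw [← List.append_assoc (x.take i), ← hx]
  · rintro h x₁ c x₂ rfl
    have := h ((p ++ x₁).length + 1) (by simp) (by simp)
    simpa using this

theorem sat_untl_iff {L : Language A} (hL : L ∈ C) (φ ψ : Formula C) (p v : List A) :
    (Formula.untl L hL φ ψ).Sat (p ++ v) p.length ↔ ∃ x s, v = x ++ s ∧ x ∈ middle L φ p s ∧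
      ψ.Sat (p ++ x ++ s) ((p ++ x).length + 1) := by
  constructor
  · rintro ⟨j, hpj, hj, hw, hφ, hψ⟩
    obtain ⟨m, rfl⟩ := Nat.exists_eq_add_of_lt hpj
    have hm : m ≤ v.length := by
      rw [List.length_append] at hj
      omega
    have hlen : (p ++ v.take m).length + 1 = p.length + m + 1 := by simp [hm]
    refine ⟨v.take m, v.drop m, by simp, (mem_middle_iff _ _ _ _ _).2 ?_, ?_⟩ <;>
      rw [hlen, List.append_assoc, List.take_append_drop]
    exacts [⟨hw, hφ⟩, hψ]
  · rintro ⟨x, s, rfl, hx, hψ⟩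
    obtain ⟨hw, hφ⟩ := (mem_middle_iff _ _ _ _ _).1 hx
    rw [List.append_assoc] at hw hφ hψ
    exact ⟨_, by simp, by simp, hw, by simpa using hφ, hψ⟩

theorem sat_snce_iff {L : Language A} (hL : L ∈ C) (φ ψ : Formula C) (u s : List A) :
    (Formula.snce L hL φ ψ).Sat (u ++ s) (u.length + 1) ↔ ∃ p x, u = p ++ x ∧
      x ∈ middle L φ p s ∧ ψ.Sat (p ++ x ++ s) p.length := by
  constructor
  · rintro ⟨j, hj, hw, hφ, hψ⟩
    have hlen : (u.take j).length = j := by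
      rw [List.length_take]
      omega
    refine ⟨u.take j, u.drop j, by simp, (mem_middle_iff _ _ _ _ _).2 ?_, ?_⟩ <;>
      rw [List.take_append_drop, hlen]
    exacts [⟨hw, hφ⟩, hψ]
  · rintro ⟨p, x, rfl, hx, hψ⟩
    obtain ⟨hw, hφ⟩ := (mem_middle_iff _ _ _ _ _).1 hx
    exact ⟨_, by simp, hw, hφ, hψ⟩

section

variable {X : Type*} {f : List A → X} {φ ψ : Formula C} {L : Language A}

theorem middle_congr (hf : IsFiniteCongruence (SF C) f) (hφ : IsInvariant f φ) {p p' s s' : List A}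
    (hp : f p = f p') (hs : f s = f s') : middle L φ p s = middle L φ p' s' := by
  ext x
  simp only [middle, mem_ofPred]
  refine and_congr_right fun _ => forall_congr' fun x₁ => forall_congr' fun c =>
    forall_congr' fun x₂ => imp_congr_right fun _ => ?_
  exact hφ.letter c (hf.append hp rfl) (hf.append rfl hs)

theorem middle_mem_SF [Finite A] (hC : IsPrevariety C) (hf : IsFiniteCongruence (SF C) f)
    (hφ : IsInvariant f φ) (hL : L ∈ SF C) (p s : List A) : middle L φ p s ∈ SF C := by
  have hB := isBooleanClass_SF hC
  have := hf.finite
  have hbad : ofPred (fun x => ∃ y : X × A × X, ∃ x₁ r, (f x₁ = y.1 ∧ ∃ v₁ v₂, f v₁ = y.1 ∧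
      f v₂ = y.2.2 ∧ ¬ φ.Sat ((p ++ v₁) ++ y.2.1 :: (v₂ ++ s)) ((p ++ v₁).length + 1)) ∧
      (∃ c x₂, c = [y.2.1] ∧ f x₂ = y.2.2 ∧ c ++ x₂ = r) ∧ x₁ ++ r = x) ∈ SF C :=
    hB.exists_mem _ fun y => ofPred_concat_mem_SF _ _
      (hB.and_mem _ _ (hf.fiber_mem _) (hB.const_mem _))
      (ofPred_concat_mem_SF _ _ (ofPred_singleton_mem_SF _) (hf.fiber_mem _))
  have h := hB.and_mem _ _ (show ofPred (· ∈ L) ∈ SF C from hL) (hB.not_mem _ hbad)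
  convert h using 1
  ext x
  simp only [middle, mem_ofPred]
  refine and_congr_right fun _ => ⟨?_, fun h x₁ c x₂ hx => ?_⟩
  · rintro h ⟨⟨y₁, a, y₂⟩, x₁, r, ⟨rfl, v₁, v₂, h₁, h₂, hv⟩, ⟨c, x₂, rfl, rfl, rfl⟩, rfl⟩
    refine hv ((hφ.letter a (hf.append rfl h₁) (hf.append h₂ rfl)).2 (h x₁ a x₂ rfl))
  · by_contra hn
    exact h ⟨(f x₁, c, f x₂), x₁, c :: x₂, ⟨rfl, x₁, x₂, rfl, rfl, hn⟩, ⟨[c], x₂, rfl, rfl, rfl⟩,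
      hx.symm⟩

/-- The language of the words that may follow the prefix `p` when `φ U_L ψ` holds at the last
position of `p`. -/
def untlSuffix (L : Language A) (φ ψ : Formula C) (p : List A) : Language A :=
  ofPred fun v => ∃ x s, v = x ++ s ∧ x ∈ middle L φ p s ∧
    ψ.Sat (p ++ x ++ s) ((p ++ x).length + 1)

theorem untlSuffix_congr (hf : IsFiniteCongruence (SF C) f) (hφ : IsInvariant f φ)
    (hψ : IsInvariant f ψ) {p p' : List A} (hp : f p = f p') :
    untlSuffix L φ ψ p = untlSuffix L φ ψ p' := by
  ext v
  simp only [untlSuffix, mem_ofPred]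
  refine exists_congr fun x => exists_congr fun s => and_congr_right fun _ => ?_
  rw [middle_congr hf hφ hp rfl]
  refine and_congr_right fun _ => ?_
  cases s with
  | nil => simpa using hψ.last (hf.append hp (rfl : f x = f x))
  | cons b y => exact hψ.letter b (hf.append hp rfl) rfl

theorem untlSuffix_mem_SF [Finite A] (hC : IsPrevariety C) (hf : IsFiniteCongruence (SF C) f)
    (hφ : IsInvariant f φ) (hψ : IsInvariant f ψ) (hL : L ∈ SF C) (p : List A) :
    untlSuffix L φ ψ p ∈ SF C := by
  have hB := isBooleanClass_SF hC
  have := hf.finite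
  have hlast : ofPred (fun v => ψ.Sat (p ++ v) ((p ++ v).length + 1)) ∈ SF C :=
    hf.mem_of_saturates hB fun _ _ huv => (hψ.last (hf.append rfl huv)).1
  have hmid : ∀ b y, ofPred (fun x => ψ.Sat (p ++ x ++ b :: y) ((p ++ x).length + 1)) ∈ SF C :=
    fun b y => hf.mem_of_saturates hB fun _ _ huv => (hψ.letter b (hf.append rfl huv) rfl).1
  -- The case distinction is on the letter at the target position and the class of the rest.
  have h := hB.or_mem _ _
    (hB.and_mem _ _ (show ofPred (· ∈ middle L φ p []) ∈ SF C from
      middle_mem_SF hC hf hφ hL p []) hlast)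
    (hB.exists_mem (ι := A × Set.range f) _ fun z => ofPred_concat_mem_SF _ _
      (hB.and_mem _ _ (show ofPred (· ∈ middle L φ p (z.1 :: z.2.2.choose)) ∈ SF C from
        middle_mem_SF hC hf hφ hL p _) (hmid z.1 z.2.2.choose))
      (ofPred_concat_mem_SF _ _ (ofPred_singleton_mem_SF z.1) (hf.fiber_mem z.2.1)))
  convert h using 1
  ext v
  simp only [untlSuffix, mem_ofPred]
  have hcons : ∀ {b : A} {y y'}, f y = f y' → f (b :: y) = f (b :: y') := fun {b y y'} h =>
    hf.append (rfl : f [b] = f [b]) h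
  constructor
  · rintro ⟨x, s, rfl, hx, hs⟩
    cases s with
    | nil =>
      rw [List.append_nil] at hs ⊢
      exact .inl ⟨hx, hs⟩
    | cons b y =>
      have hy := (⟨f y, y, rfl⟩ : Set.range f).2.choose_spec
      refine .inr ⟨(b, ⟨f y, y, rfl⟩), x, b :: y, ⟨?_, ?_⟩, ⟨[b], y, rfl, rfl, rfl⟩, rfl⟩
      · rwa [middle_congr hf hφ rfl (hcons hy)]
      · exact (hψ.letter b rfl hy).2 hs
  · rintro (⟨hx, hs⟩ | ⟨⟨b, ⟨_, hz⟩⟩, x, _, ⟨hx, hs⟩, ⟨_, y, rfl, hy, rfl⟩, rfl⟩)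
    · exact ⟨v, [], by simp, hx, by simpa using hs⟩
    · have hy' := hz.choose_spec.trans hy.symm
      refine ⟨x, b :: y, rfl, ?_, (hψ.letter b rfl hy').1 hs⟩
      rwa [← middle_congr hf hφ rfl (hcons hy')]

/-- The language of the words that may precede the suffix `s` when `φ S_L ψ` holds at the first
position of `s`. -/
def sncePrefix (L : Language A) (φ ψ : Formula C) (s : List A) : Language A :=
  ofPred fun u => ∃ p x, u = p ++ x ∧ x ∈ middle L φ p s ∧ ψ.Sat (p ++ x ++ s) p.length

theorem IsInvariant.sat_length_congr (hψ : IsInvariant f ψ) {q q' : List A} (b : A)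
    {v v' : List A} (hq : f q = f q') (hv : f v = f v') :
    ψ.Sat (q ++ [b] ++ v) (q ++ [b]).length ↔ ψ.Sat (q' ++ [b] ++ v') (q' ++ [b]).length := by
  simpa using hψ.letter b hq hv

theorem sncePrefix_congr (hf : IsFiniteCongruence (SF C) f) (hφ : IsInvariant f φ)
    (hψ : IsInvariant f ψ) {s s' : List A} (hs : f s = f s') :
    sncePrefix L φ ψ s = sncePrefix L φ ψ s' := by
  ext v
  simp only [sncePrefix, mem_ofPred]
  refine exists_congr fun p => exists_congr fun x => and_congr_right fun _ => ?_
  rw [middle_congr hf hφ rfl hs]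
  refine and_congr_right fun _ => ?_
  rcases p.eq_nil_or_concat' with rfl | ⟨q, b, rfl⟩
  · exact hψ.first (hf.append rfl hs)
  · rw [List.append_assoc, List.append_assoc _ x s']
    exact hψ.sat_length_congr b rfl (hf.append rfl hs)

theorem sncePrefix_mem_SF [Finite A] (hC : IsPrevariety C) (hf : IsFiniteCongruence (SF C) f)
    (hφ : IsInvariant f φ) (hψ : IsInvariant f ψ) (hL : L ∈ SF C) (s : List A) :
    sncePrefix L φ ψ s ∈ SF C := by
  have hB := isBooleanClass_SF hC
  have := hf.finite
  have hfirst : ofPred (fun u => ψ.Sat (u ++ s) 0) ∈ SF C :=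
    hf.mem_of_saturates hB fun _ _ huv => (hψ.first (hf.append huv rfl)).1
  have hmid : ∀ b q, ofPred (fun x => ψ.Sat (q ++ [b] ++ (x ++ s)) (q ++ [b]).length) ∈ SF C :=
    fun b q => hf.mem_of_saturates hB fun _ _ huv =>
      (hψ.sat_length_congr b rfl (hf.append huv rfl)).1
  have h := hB.or_mem _ _
    (hB.and_mem _ _ (show ofPred (· ∈ middle L φ [] s) ∈ SF C from
      middle_mem_SF hC hf hφ hL [] s) hfirst)
    (hB.exists_mem (ι := A × Set.range f) _ fun z => ofPred_concat_mem_SF _ _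
      (ofPred_concat_mem_SF _ _ (hf.fiber_mem z.2.1) (ofPred_singleton_mem_SF z.1))
      (hB.and_mem _ _ (show ofPred (· ∈ middle L φ (z.2.2.choose ++ [z.1]) s) ∈ SF C from
        middle_mem_SF hC hf hφ hL _ s) (hmid z.1 z.2.2.choose)))
  convert h using 1
  ext u
  simp only [sncePrefix, mem_ofPred]
  have hsnoc : ∀ {b : A} {y y'}, f y = f y' → f (y ++ [b]) = f (y' ++ [b]) := fun h =>
    hf.append h rfl
  constructor
  · rintro ⟨p, x, rfl, hx, hs⟩
    rcases p.eq_nil_or_concat' with rfl | ⟨q, b, rfl⟩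
    · exact .inl ⟨hx, hs⟩
    · have hq := (⟨f q, q, rfl⟩ : Set.range f).2.choose_spec
      refine .inr ⟨(b, ⟨f q, q, rfl⟩), q ++ [b], x, ⟨q, [b], rfl, rfl, rfl⟩, ⟨?_, ?_⟩, rfl⟩
      · rwa [middle_congr hf hφ (hsnoc hq) rfl]
      · rw [List.append_assoc] at hs
        exact (hψ.sat_length_congr b hq rfl).2 hs
  · rintro (⟨hx, hs⟩ | ⟨⟨b, ⟨_, hz⟩⟩, _, x, ⟨q, _, hq, rfl, rfl⟩, ⟨hx, hs⟩, rfl⟩)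
    · exact ⟨[], u, rfl, hx, hs⟩
    · have hq' := hz.choose_spec.trans hq.symm
      refine ⟨q ++ [b], x, rfl, ?_, ?_⟩
      · rwa [← middle_congr hf hφ (hsnoc hq') rfl]
      · rw [List.append_assoc]
        exact (hψ.sat_length_congr b hq' rfl).1 hs

end

/-- A finite congruence can be refined so as to saturate finitely many languages, here a family of
languages that is indexed by words and constant on classes. -/
theorem IsFiniteCongruence.exists_refinement [Finite A] (hC : IsPrevariety C) {X : Type u}
    {f : List A → X} (hf : IsFiniteCongruence (SF C) f) (V : List A → Language A)
    (hV : ∀ p, V p ∈ SF C) (hVf : ∀ {p p'}, f p = f p' → V p = V p') :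
    ∃ (Y : Type u) (g : List A → Y), IsFiniteCongruence (SF C) g ∧
      (∀ {u v}, g u = g v → f u = f v) ∧ ∀ p, Saturates g (V p) := by
  have hB := isBooleanClass_SF hC
  have := hf.finite
  choose Y h hh hhV using fun x : Set.range f => exists_finiteCongruence_SF hC (hV x.2.choose)
  refine ⟨_, _, hf.prodMk hB (.pi hB hh), fun huv => (Prod.mk.inj huv).1, fun p u v huv => ?_⟩
  have h1 := hhV ⟨f p, p, rfl⟩ (congrFun (Prod.mk.inj huv).2 _)
  have h2 := (⟨f p, p, rfl⟩ : Set.range f).2.choose_spec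
  rwa [hVf h2] at h1

theorem exists_isInvariant [Finite A] (hC : IsPrevariety C) (φ : Formula C) :
    ∃ (X : Type u) (f : List A → X), IsFiniteCongruence (SF C) f ∧ IsInvariant f φ := by
  have hB := isBooleanClass_SF hC
  have htriv : IsFiniteCongruence (SF C) (fun _ : List A => PUnit.unit.{u + 1}) :=
    ⟨inferInstance, fun _ _ => rfl, fun _ => hB.const_mem _⟩
  have hpair : ∀ φ ψ : Formula C,
      (∃ (X : Type u) (f : List A → X), IsFiniteCongruence (SF C) f ∧ IsInvariant f φ) →
      (∃ (X : Type u) (f : List A → X), IsFiniteCongruence (SF C) f ∧ IsInvariant f ψ) →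
      ∃ (X : Type u) (f : List A → X), IsFiniteCongruence (SF C) f ∧ IsInvariant f φ ∧
        IsInvariant f ψ := by
    rintro φ ψ ⟨X, f, hf, hφ⟩ ⟨Y, g, hg, hψ⟩
    exact ⟨_, _, hf.prodMk hB hg, hφ.refine fun h => (Prod.mk.inj h).1,
      hψ.refine fun h => (Prod.mk.inj h).2⟩
  induction φ with
  | top => exact ⟨_, _, htriv, fun _ => Iff.rfl, fun _ => Iff.rfl, fun _ _ _ _ _ => Iff.rfl⟩
  | atMin => exact ⟨_, _, htriv, by simp [Formula.Sat], by simp [Formula.Sat], by simp [Formula.Sat]⟩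
  | atMax => exact ⟨_, _, htriv, by simp [Formula.Sat], by simp [Formula.Sat], by simp [Formula.Sat]⟩
  | letter b =>
    exact ⟨_, _, htriv, by simp [Formula.Sat, label], by simp [Formula.Sat, label],
      by simp [Formula.Sat, label]⟩
  | or φ ψ ihφ ihψ =>
    obtain ⟨X, f, hf, hφ, hψ⟩ := hpair φ ψ ihφ ihψ
    exact ⟨X, f, hf, fun h => or_congr (hφ.first h) (hψ.first h),
      fun h => or_congr (hφ.last h) (hψ.last h),
      fun a _ _ h h' => or_congr (hφ.letter a h h') (hψ.letter a h h')⟩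
  | and φ ψ ihφ ihψ =>
    obtain ⟨X, f, hf, hφ, hψ⟩ := hpair φ ψ ihφ ihψ
    exact ⟨X, f, hf, fun h => and_congr (hφ.first h) (hψ.first h),
      fun h => and_congr (hφ.last h) (hψ.last h),
      fun a _ _ h h' => and_congr (hφ.letter a h h') (hψ.letter a h h')⟩
  | not φ ih =>
    obtain ⟨X, f, hf, hφ⟩ := ih
    exact ⟨X, f, hf, fun h => not_congr (hφ.first h), fun h => not_congr (hφ.last h),
      fun a _ _ h h' => not_congr (hφ.letter a h h')⟩
  | untl L hL φ ψ ihφ ihψ =>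
    obtain ⟨X, f, hf, hφ, hψ⟩ := hpair φ ψ ihφ ihψ
    obtain ⟨Y, g, hg, hgf, hgV⟩ := hf.exists_refinement hC (untlSuffix L φ ψ)
      (untlSuffix_mem_SF hC hf hφ hψ (.base L hL)) (untlSuffix_congr hf hφ hψ)
    have hsat : ∀ p v, (Formula.untl L hL φ ψ).Sat (p ++ v) p.length ↔
        v ∈ untlSuffix L φ ψ p := sat_untl_iff hL φ ψ
    refine ⟨Y, g, hg, fun {w w'} h => ?_, fun {w w'} h => ?_, fun {u u'} a {v v'} hu hv => ?_⟩
    · exact (hsat [] w).trans (((hgV []).iff h).trans (hsat [] w').symm)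
    · -- There is no position after the last one.
      constructor <;>
      · rintro ⟨j, hj, hj', -⟩
        omega
    · have h1 := hsat (u ++ [a]) v
      have h2 := hsat (u' ++ [a]) v'
      rw [untlSuffix_congr hf hφ hψ (hf.append (hgf hu) rfl), (hgV _).iff hv, ← h2] at h1
      simpa using h1
  | snce L hL φ ψ ihφ ihψ =>
    obtain ⟨X, f, hf, hφ, hψ⟩ := hpair φ ψ ihφ ihψ
    obtain ⟨Y, g, hg, hgf, hgV⟩ := hf.exists_refinement hC (sncePrefix L φ ψ)
      (sncePrefix_mem_SF hC hf hφ hψ (.base L hL)) (sncePrefix_congr hf hφ hψ)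
    have hsat : ∀ u s, (Formula.snce L hL φ ψ).Sat (u ++ s) (u.length + 1) ↔
        u ∈ sncePrefix L φ ψ s := sat_snce_iff hL φ ψ
    refine ⟨Y, g, hg, fun {w w'} h => ?_, fun {w w'} h => ?_, fun {u u'} a {v v'} hu hv => ?_⟩
    · -- There is no position before the first one.
      constructor <;>
      · rintro ⟨j, hj, -⟩
        omega
    · have h1 := hsat w []
      have h2 := hsat w' []
      rw [(hgV []).iff h, ← h2] at h1
      simpa using h1
    · have hav : f (a :: v) = f (a :: v') := hf.append (rfl : f [a] = f [a]) (hgf hv)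
      rw [hsat, hsat, (hgV _).iff hu, sncePrefix_congr hf hφ hψ hav]

theorem LTLP_subset_SF [Finite A] (hC : IsPrevariety C) : LTLP C ⊆ SF C := by
  rintro _ ⟨φ, rfl⟩
  obtain ⟨X, f, hf, hφ⟩ := exists_isInvariant hC φ
  exact hf.mem_of_saturates (isBooleanClass_SF hC) fun _ _ h => (hφ.first h).1

/-! ### From the star-free closure to pure future formulas -/

/-- The power `v ^ n` of the word `v`. -/
def wordPow (v : List A) (n : ℕ) : List A :=
  (List.replicate n v).flatten

theorem wordPow_succ (v : List A) (n : ℕ) : wordPow v (n + 1) = v ++ wordPow v n := by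
  simp [wordPow, List.replicate_succ]

/-- Membership in `L` does not distinguish powers of `v` with exponents at least `m`. -/
def IsStable (L : Language A) (v : List A) (m : ℕ) : Prop :=
  ∀ ⦃n n'⦄, m ≤ n → m ≤ n' → ∀ x y, x ++ (wordPow v n ++ y) ∈ L → x ++ (wordPow v n' ++ y) ∈ L

theorem IsStable.mono {L : Language A} {v : List A} {m m' : ℕ} (h : IsStable L v m)
    (hm : m ≤ m') : IsStable L v m' :=
  fun _ _ hn hn' => h (hm.trans hn) (hm.trans hn')

theorem append_eq_append_wordPow {v : List A} {n : ℕ} {k l x y : List A}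
    (h : k ++ l = x ++ (wordPow v n ++ y)) :
    (∃ r, x = k ++ r ∧ l = r ++ (wordPow v n ++ y)) ∨
    (∃ r, y = r ++ l ∧ k = x ++ (wordPow v n ++ r)) ∨
    ∃ i j s t, i + j + 1 = n ∧ k = x ++ (wordPow v i ++ s) ∧ l = t ++ (wordPow v j ++ y) ∧
      v = s ++ t := by
  induction n generalizing x with
  | zero =>
    rcases List.append_eq_append_iff.1 h with ⟨r, hr, hr'⟩ | ⟨r, hr, hr'⟩
    · exact .inl ⟨r, hr, hr'⟩
    · exact .inr (.inl ⟨r, hr', hr⟩)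
  | succ n ih =>
    rw [wordPow_succ, List.append_assoc, ← List.append_assoc x] at h
    rcases ih h with ⟨r, hr, rfl⟩ | ⟨r, rfl, rfl⟩ | ⟨i, j, s, t, hij, rfl, rfl, hv⟩
    · rcases List.append_eq_append_iff.1 hr with ⟨s, rfl, hs⟩ | ⟨s, rfl, rfl⟩
      · exact .inr (.inr ⟨0, n, s, r, by omega, by simp [wordPow], rfl, hs⟩)
      · exact .inl ⟨s, rfl, by simp [wordPow_succ]⟩
    · exact .inr (.inl ⟨r, rfl, by simp [wordPow_succ]⟩)
    · exact .inr (.inr ⟨i + 1, j, s, t, by omega, by simp [wordPow_succ], rfl, hv⟩)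

/-- If a power of `v` is cut into two parts, one of them contains a large power of `v`, whose
exponent can be changed. -/
theorem IsStable.mul {K L : Language A} {v : List A} {m : ℕ} (hK : IsStable K v m)
    (hL : IsStable L v m) : IsStable (K * L) v (2 * m + 1) := by
  intro n n' hn hn' x y hxy
  obtain ⟨k, hk, l, hl, hkl⟩ := Language.mem_mul.1 hxy
  rw [Language.mem_mul]
  rcases append_eq_append_wordPow hkl with ⟨r, rfl, rfl⟩ | ⟨r, rfl, rfl⟩ |
    ⟨i, j, s, t, hij, rfl, rfl, rfl⟩
  · exact ⟨k, hk, _, hL (n' := n') (by omega) (by omega) r y hl, by simp⟩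
  · exact ⟨_, hK (n' := n') (by omega) (by omega) x r hk, l, hl, by simp⟩
  · obtain ⟨i', j', hij', hi, hj⟩ : ∃ i' j', i' + j' + 1 = n' ∧ (i' = i ∨ m ≤ i ∧ m ≤ i') ∧
        (j' = j ∨ m ≤ j ∧ m ≤ j') := by
      rcases le_total m i with h | h
      · exact ⟨n' - 1 - min j m, min j m, by omega, by omega, by omega⟩
      · exact ⟨i, n' - 1 - i, by omega, by omega, by omega⟩
    refine ⟨x ++ (wordPow (s ++ t) i' ++ s), ?_, t ++ (wordPow (s ++ t) j' ++ y), ?_, ?_⟩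
    · rcases hi with rfl | ⟨h, h'⟩
      exacts [hk, hK h h' x s hk]
    · rcases hj with rfl | ⟨h, h'⟩
      exacts [hl, hL h h' t y hl]
    · have hadd : wordPow (s ++ t) n' = wordPow (s ++ t) i' ++ (s ++ t) ++ wordPow (s ++ t) j' := by
        rw [← hij', show i' + j' + 1 = i' + (1 + j') by omega]
        simp [wordPow, List.replicate_add]
      simp [hadd]

/-- A finite congruence is the kernel of a morphism into a finite monoid. -/
theorem IsFiniteCongruence.exists_monoid (hB : IsBooleanClass C) {X : Type u} {f : List A → X}
    (hf : IsFiniteCongruence C f) :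
    ∃ (N : Type u) (_ : Monoid N) (_ : Finite N) (g : A → N), recognizedBy g ⊆ C ∧
      ∀ u v : List A, (u.map g).prod = (v.map g).prod → f u = f v := by
  let c : Con (FreeMonoid A) :=
    { r := fun u v => f u.toList = f v.toList
      iseqv := ⟨fun _ => rfl, fun h => h.symm, fun h h' => h.trans h'⟩
      mul' := fun h h' => hf.append h h' }
  let g : A → c.Quotient := fun a => c.mk' (FreeMonoid.of a)
  have hprod : ∀ w : List A, (w.map g).prod = c.mk' (FreeMonoid.ofList w) := by
    intro w
    induction w with
    | nil => rfl
    | cons a w ih =>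
      rw [List.map_cons, List.prod_cons, ih, FreeMonoid.ofList_cons, map_mul]
  have hg : ∀ u v : List A, (u.map g).prod = (v.map g).prod ↔ f u = f v := by
    intro u v
    rw [hprod, hprod]
    exact c.eq
  have hfin : Finite c.Quotient := by
    have := hf.finite
    refine Finite.of_injective (β := X) (fun x => Con.liftOn x (fun w => f w.toList) fun _ _ h => h) ?_
    intro x y
    induction x using Con.induction_on
    induction y using Con.induction_on
    exact fun h => c.eq.2 h
  refine ⟨c.Quotient, inferInstance, hfin, g, ?_, fun u v => (hg u v).1⟩
  rintro _ ⟨S, rfl⟩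
  refine hf.mem_of_saturates hB fun u v huv hu => ?_
  rw [mem_ofPred] at hu ⊢
  rwa [← (hg u v).2 huv]

theorem prod_map_prodMk {M N : Type*} [Monoid M] [Monoid N] (g : A → M) (h : A → N) (w : List A) :
    (w.map fun a => (g a, h a)).prod = ((w.map g).prod, (w.map h).prod) := by
  induction w with
  | nil => rfl
  | cons a w ih => simp [ih]

theorem recognizedBy_prod_subset (hB : IsBooleanClass C) {M N : Type*} [Monoid M] [Monoid N]
    [Finite M] [Finite N] {g : A → M} {h : A → N} (hg : recognizedBy g ⊆ C)
    (hh : recognizedBy h ⊆ C) : recognizedBy (fun a => (g a, h a)) ⊆ C := by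
  rintro _ ⟨S, rfl⟩
  have h1 := hB.exists_mem (fun (x : S) w => (w.map g).prod ∈ ({x.1.1} : Set M) ∧
    (w.map h).prod ∈ ({x.1.2} : Set N)) fun x => hB.and_mem _ _ (hg ⟨_, rfl⟩) (hh ⟨_, rfl⟩)
  convert h1 using 2
  funext w
  rw [prod_map_prodMk]
  apply propext
  constructor
  · exact fun h => ⟨⟨_, h⟩, rfl, rfl⟩
  · rintro ⟨⟨⟨x, y⟩, hx⟩, rfl, rfl⟩
    exact hx

/-- For a language of `SF(C)` there is a morphism recognizing only languages of `C` relative to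
which the language is aperiodic. -/
theorem exists_isStable_of_mem_SF (hC : IsPrevariety C) {L : Language A} (hL : L ∈ SF C) :
    ∃ (N : Type u) (_ : Monoid N) (_ : Finite N) (g : A → N), recognizedBy g ⊆ C ∧
      ∃ m, ∀ v : List A, IsIdempotentElem (v.map g).prod → IsStable L v m := by
  have hB := hC.isBooleanClass
  induction hL with
  | base L hL =>
    obtain ⟨X, f, hf, hfL⟩ := hC.exists_finiteCongruence hL
    obtain ⟨N, _, _, g, hg, hgf⟩ := hf.exists_monoid hB
    refine ⟨N, _, ‹_›, g, hg, 1, fun v hv n n' hn hn' x y => hfL (hgf _ _ ?_)⟩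
    have hpow : ∀ n, 1 ≤ n → ((wordPow v n).map g).prod = (v.map g).prod := by
      intro n hn
      induction n, hn using Nat.le_induction with
      | base => simp [wordPow]
      | succ n _ ih => rw [wordPow_succ, List.map_append, List.prod_append, ih, hv.eq]
    simp [hpow n hn, hpow n' hn']
  | letter a =>
    refine ⟨PUnit, inferInstance, inferInstance, fun _ => 1, ?_, 2, fun v _ n n' hn hn' x y h => ?_⟩
    · rintro _ ⟨S, rfl⟩
      simpa using hB.const_mem (1 ∈ S)
    · -- The word `a` has no square factor other than the empty word.
      have hv : v = [] := by
        have hlen := congrArg List.length (show x ++ (wordPow v n ++ y) = [a] from h)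
        simp only [wordPow, List.length_append, List.length_flatten, List.map_replicate,
          List.sum_replicate, smul_eq_mul, List.length_singleton] at hlen
        by_contra hne
        have := List.length_pos_of_ne_nil hne
        nlinarith
      subst hv
      simpa [wordPow] using h
  | union K L _ _ ihK ihL =>
    obtain ⟨M, _, _, g, hg, m, hm⟩ := ihK
    obtain ⟨N, _, _, h, hh, m', hm'⟩ := ihL
    refine ⟨M × N, _, inferInstance, _, recognizedBy_prod_subset hB hg hh, max m m', fun v hv => ?_⟩
    rw [prod_map_prodMk] at hv
    have hK := (hm v (congrArg Prod.fst hv)).mono (le_max_left m m')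
    have hL := (hm' v (congrArg Prod.snd hv)).mono (le_max_right m m')
    exact fun n n' hn hn' x y => Or.imp (hK hn hn' x y) (hL hn hn' x y)
  | compl K _ ih =>
    obtain ⟨N, _, _, g, hg, m, hm⟩ := ih
    exact ⟨N, _, ‹_›, g, hg, m, fun v hv n n' hn hn' x y h h' => h (hm v hv hn' hn x y h')⟩
  | concat K L _ _ ihK ihL =>
    obtain ⟨M, _, _, g, hg, m, hm⟩ := ihK
    obtain ⟨N, _, _, h, hh, m', hm'⟩ := ihL
    refine ⟨M × N, _, inferInstance, _, recognizedBy_prod_subset hB hg hh, 2 * max m m' + 1,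
      fun v hv => ?_⟩
    rw [prod_map_prodMk] at hv
    have hK := (hm v (congrArg Prod.fst hv)).mono (le_max_left m m')
    have hL := (hm' v (congrArg Prod.snd hv)).mono (le_max_right m m')
    exact hK.mul hL

theorem SF_subset_Future [Finite A] (hC : IsPrevariety C) : SF C ⊆ Future C := by
  intro L hL
  obtain ⟨N, _, _, g, hg, m, hm⟩ := exists_isStable_of_mem_SF hC hL
  obtain ⟨X, f, hf, hfL⟩ := exists_finiteCongruence_SF hC hL
  -- The minimal automaton of `L`.
  let Q := Set.range L.leftQuotient
  have hQ : Finite Q := by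
    have := hf.finite
    refine Finite.of_injective (fun K : Q => f K.2.choose) fun K K' h => Subtype.ext ?_
    rw [← K.2.choose_spec, ← K'.2.choose_spec]
    ext v
    exact hfL.iff (hf.append h rfl)
  let δ : A → Q → Q := fun a K => ⟨K.1.leftQuotient [a], by
    obtain ⟨_, y, rfl⟩ := K
    exact ⟨y ++ [a], Language.leftQuotient_append _ _ _⟩⟩
  have hact : ∀ (w : List A) (K : Q), (act δ w K).1 = K.1.leftQuotient w := by
    intro w
    induction w with
    | nil => exact fun K => rfl
    | cons a w ih =>
      intro K
      rw [act_cons, ih]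
      exact (Language.leftQuotient_append _ _ _).symm
  have hrel : IsRelAperiodic g δ Set.univ := by
    intro v _ hv
    refine ⟨m, funext fun K => Subtype.ext ?_⟩
    rw [← act_flatten_replicate, ← act_flatten_replicate, hact, hact]
    obtain ⟨_, x, rfl⟩ := K
    ext y
    have h : ∀ n, y ∈ (L.leftQuotient x).leftQuotient (List.replicate n v).flatten ↔
        x ++ (wordPow v n ++ y) ∈ L := fun n => Iff.rfl
    rw [h, h]
    exact ⟨hm v hv le_rfl (by omega) x y, hm v hv (by omega) le_rfl x y⟩
  have := Fintype.ofFinite A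
  have hmain := exists_Future_of_isRelAperiodic _ A Q g δ rfl Finset.univ (by simpa using hrel)
    ⟨L, [], rfl⟩
  choose F hF hF' using hmain
  apply Future.mono hg
  have hBool := isBooleanClass_Future (recognizedBy g)
  have h := hBool.exists_mem (fun (K : Q) w => w ∈ F K ∧ [] ∈ K.1) fun K =>
    hBool.and_mem _ _ (hF K) (hBool.const_mem _)
  convert h using 1
  ext w
  have hw : w ∈ L ↔ [] ∈ (act δ w ⟨L, [], rfl⟩).1 := by
    rw [hact, Language.mem_leftQuotient, List.append_nil]
  rw [hw, mem_ofPred]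
  constructor
  · exact fun h => ⟨_, (hF' _ w (by simp)).2 rfl, h⟩
  · rintro ⟨K, hK, hK'⟩
    rwa [(hF' K w (by simp)).1 hK]

end StarFreeLTL

theorem theorem7p3 {A : Type*} [Finite A] (C : Set (Language A)) (hC : StarFreeLTL.IsPrevariety C) :
    StarFreeLTL.SF C = StarFreeLTL.LTL C ∧ StarFreeLTL.LTL C = StarFreeLTL.LTLP C := by
  have h1 : StarFreeLTL.SF C ⊆ StarFreeLTL.LTL C :=
    (StarFreeLTL.SF_subset_Future hC).trans (StarFreeLTL.future_subset_LTL hC)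
  have h2 : StarFreeLTL.LTL C ⊆ StarFreeLTL.LTLP C := fun _ ⟨φ, _, hφ⟩ => ⟨φ, hφ⟩
  have h3 : StarFreeLTL.LTLP C ⊆ StarFreeLTL.SF C := StarFreeLTL.LTLP_subset_SF hC
  exact ⟨h1.antisymm (h2.trans h3), h2.antisymm (h3.trans h1)⟩
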